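/- Let $A\in\{0,\star\}^{d\times d}$ and $B\in\{0,\star\}^{d\times m}$ be sparsity patterns. A pair $(A,B')$ with $B'\in\{0,\star\}^{d\times m}$ is called structurally controllable if real values can be assigned to the entries $\star$ so that the resulting linear system $\dot x=\bar A x+\bar B' u$ is controllable. Let each entry $B_{ij}=\star$ carry a cost $w_{ij}\ge 0$, and for a pattern $B'$ whose nonzero entries are among those of $B$ put $\|B'\|_w=\sum_{i,j:\,B'_{ij}\neq 0}w_{ij}$. Let $\mathcal K$ be the set of all such patterns $B'$ for which $(A,B')$ is structurally controllable, and consider the problem $$(\mathcal P_1)\qquad \min_{B'\in\mathcal K}\ \|B'\|_w .$$ Let $G(A)$ be the digraph on $v_1,\dots,v_d$ with an edge $(v_j,v_i)$ whenever $A_{ij}\ne 0$; let $\Gamma(A)$ be the bipartite graph with sides $\{v^1_1,\dots,v^1_d\}$ and $\{v^2_1,\dots,v^2_d\}$ and edges $(v^1_j,v^2_i)$ for $A_{ij}\neq0$; and let $\Gamma(A,B)$ be obtained from $\Gamma(A)$ by adding vertices $u_1,\dots,u_m$ to the first side and the input edges $(u_j,v^2_i)$ for $B_{ij}\neq 0$.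 **Theorem.** Assume that $(A,B)$ is structurally controllable, that $G(A)$ is strongly connected, and that $\Gamma(A)$ has no perfect matching. Give cost $0$ to every edge $(v^1_r,v^2_k)$ of $\Gamma(A,B)$ and cost $w_{kj}$ to every input edge $(u_j,v^2_k)$. Let $M^*$ be any maximum matching of $\Gamma(A,B)$ that has minimum total cost among all maximum matchings, and let $B^*\in\{0,\star\}^{d\times m}$ be given by $B^*_{\ell k}=\star$ if and only if $(u_k,v^2_\ell)\in M^*$. Then $(A,B^*)$ is structurally controllable and $B^*$ solves $(\mathcal P_1)$. Moreover, there is an algorithm (one fixed program for a random access machine with real registers, where copying, comparing, adding and subtracting real numbers take unit time) which, for all $d,m$ and all $(A,B,w)$ as above, computes from $(A,B,w)$ a matrix $B^*$ that arises in this way from a minimum cost maximum matching, in $O((d+m)^3)$ steps, with an absolute implied constant. -/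

import Mathlib

namespace StructCtrl

/-! ### Sparsity matrices, controllability, structural controllability -/

/-- Matrices with entries in `{0, ⋆}`: `false` is a fixed zero, `true` is a free parameter `⋆`. -/
abbrev SparsityMatrix (n k : ℕ) := Matrix (Fin n) (Fin k) Bool

/-- `R` is obtained from `S` by giving real values to the star entries. -/
def IsRealization {n k : ℕ} (S : SparsityMatrix n k) (R : Matrix (Fin n) (Fin k) ℝ) : Prop :=
  ∀ i j, S i j = false → R i j = 0

/-- Controllability of `x' = A x + B u`: every state can be steered to every state in finite
time by a continuous input. -/
def Controllable {d m : ℕ} (A : Matrix (Fin d) (Fin d) ℝ) (B : Matrix (Fin d) (Fin m) ℝ) : Prop :=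
  ∀ x₀ x₁ : Fin d → ℝ, ∃ T : ℝ, 0 < T ∧
    ∃ (u : ℝ → Fin m → ℝ) (x : ℝ → Fin d → ℝ),
      ContinuousOn u (Set.Icc 0 T) ∧
      (∀ t ∈ Set.Icc 0 T,
        HasDerivWithinAt x (A.mulVec (x t) + B.mulVec (u t)) (Set.Icc 0 T) t) ∧
      x 0 = x₀ ∧ x T = x₁

/-- Some numerical realization is controllable. -/
def StructurallyControllable {d m : ℕ} (A : SparsityMatrix d d) (B : SparsityMatrix d m) : Prop :=
  ∃ (A' : Matrix (Fin d) (Fin d) ℝ) (B' : Matrix (Fin d) (Fin m) ℝ),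
    IsRealization A A' ∧ IsRealization B B' ∧ Controllable A' B'

/-! ### The digraph `G(A)` -/

/-- The digraph `G(A)` on the states, with an edge from `v_j` to `v_i` whenever `A i j ≠ 0`. -/
def stateDigraph {d : ℕ} (A : SparsityMatrix d d) : Digraph (Fin d) where
  Adj j i := A i j = true

/-- Every vertex is joined to every vertex by a directed path (of length zero from a vertex
to itself). -/
def IsStronglyConnected {V : Type*} (G : Digraph V) : Prop :=
  ∀ a b : V, Relation.ReflTransGen G.Adj a b

/-! ### Bipartite graphs and matchings

A bipartite graph with sides `L` and `R` is given by its set of edges, a `Finset (L × R)`. -/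

/-- The bipartite graph `Γ(A)`: edges `(v_j¹, v_i²)` with `A i j ≠ 0`. -/
def gammaA {d : ℕ} (A : SparsityMatrix d d) : Finset (Fin d × Fin d) :=
  Finset.univ.filter fun e => A e.2 e.1 = true

/-- The bipartite graph `Γ(A,B)`; the left side consists of the states `v_j¹` (`Sum.inl j`) and
of the inputs `u_j` (`Sum.inr j`). -/
def gammaAB {d m : ℕ} (A : SparsityMatrix d d) (B : SparsityMatrix d m) :
    Finset ((Fin d ⊕ Fin m) × Fin d) :=
  Finset.univ.filter fun e => Sum.elim (fun j => A e.2 j) (fun j => B e.2 j) e.1 = true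

/-- A set of edges no two of which share a vertex. -/
def IsMatching {L R : Type*} (E M : Finset (L × R)) : Prop :=
  M ⊆ E ∧ ∀ e ∈ M, ∀ f ∈ M, (e.1 = f.1 ∨ e.2 = f.2) → e = f

/-- A matching with the largest number of edges. -/
def IsMaximumMatching {L R : Type*} (E M : Finset (L × R)) : Prop :=
  IsMatching E M ∧ ∀ M', IsMatching E M' → M'.card ≤ M.card

/-- A matching that saturates all the vertices of both sides. -/
def IsPerfectMatching {L R : Type*} (E M : Finset (L × R)) : Prop :=
  IsMatching E M ∧ (∀ l : L, ∃ e ∈ M, e.1 = l) ∧ (∀ r : R, ∃ e ∈ M, e.2 = r)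

/-- Minimum cost maximum matching. -/
def IsMCMM {L R : Type*} (E : Finset (L × R)) (c : L × R → ℝ) (M : Finset (L × R)) : Prop :=
  IsMaximumMatching E M ∧ ∀ M', IsMaximumMatching E M' → ∑ e ∈ M, c e ≤ ∑ e ∈ M', c e

/-! ### The optimisation problem and the matrix produced by the algorithm -/

/-- The cost `‖N‖_w`. -/
def connectionCost {d m : ℕ} (w : Fin d → Fin m → ℝ) (N : SparsityMatrix d m) : ℝ :=
  ∑ i, ∑ j, if N i j = true then w i j else 0

/-- The input matrices `B'` whose connections are among those of `B` and for which `(A, B')` is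
structurally controllable. -/
def admissible {d m : ℕ} (A : SparsityMatrix d d) (B : SparsityMatrix d m) :
    Set (SparsityMatrix d m) :=
  {B' | (∀ i j, B i j = false → B' i j = false) ∧ StructurallyControllable A B'}

/-- `Bs` minimises the connection cost over the admissible input matrices. -/
def SolvesMinCost {d m : ℕ} (A : SparsityMatrix d d) (B : SparsityMatrix d m)
    (w : Fin d → Fin m → ℝ) (Bs : SparsityMatrix d m) : Prop :=
  Bs ∈ admissible A B ∧ ∀ B' ∈ admissible A B, connectionCost w Bs ≤ connectionCost w B'

/-- Edge costs in `Γ(A,B)`: `0` on state edges, `w k j` on the edge from `u_j` to `v_k²`. -/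
def edgeCost {d m : ℕ} (w : Fin d → Fin m → ℝ) : (Fin d ⊕ Fin m) × Fin d → ℝ
  | (Sum.inl _, _) => 0
  | (Sum.inr j, k) => w k j

/-- The input matrix formed by the input edges of a set `M` of edges. -/
def inputMatrixOf {d m : ℕ} (M : Finset ((Fin d ⊕ Fin m) × Fin d)) : SparsityMatrix d m :=
  fun l k => decide ((Sum.inr k, l) ∈ M)

/-! ### The cost model: a real random access machine

A program is a fixed piece of code that uses registers and two-dimensional arrays of natural
numbers, and registers and two-dimensional arrays of real numbers. Array cells are addressed
through registers of natural numbers. Natural numbers can only be copied, compared, increased or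
decreased by one and set to constants, so that after `t` steps they exceed the constants of the
program and the initial contents of the memory by at most `t`. Real numbers can only be copied,
compared, added, subtracted and set to rational constants. Each elementary instruction and each
evaluation of a test takes one step. -/

/-- Memory contents. -/
structure Mem where
  /-- registers of natural numbers -/
  nreg : ℕ → ℕ
  /-- registers of real numbers -/
  rreg : ℕ → ℝ
  /-- arrays of natural numbers: name of the array, row, column -/
  narr : ℕ → ℕ → ℕ → ℕ
  /-- arrays of real numbers: name of the array, row, column -/
  rarr : ℕ → ℕ → ℕ → ℝ

/-- Elementary instructions. In array accesses, `a` names the array and `i`, `j` are the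
registers that hold the row and the column. -/
inductive Instr where
  | nconst (r k : ℕ)
  | ncopy (r r' : ℕ)
  | ninc (r : ℕ)
  | ndec (r : ℕ)
  | nload (r a i j : ℕ)
  | nstore (a i j r : ℕ)
  | rconst (x : ℕ) (q : ℚ)
  | rcopy (x y : ℕ)
  | radd (x y z : ℕ)
  | rsub (x y z : ℕ)
  | rload (x a i j : ℕ)
  | rstore (a i j x : ℕ)

/-- Tests: equality and order of two registers of natural numbers, order of two registers of
real numbers. -/
inductive Test where
  | neq (r r' : ℕ)
  | nlt (r r' : ℕ)
  | rlt (x y : ℕ)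

/-- Structured programs. -/
inductive Prog where
  | instr (c : Instr)
  | seq (p q : Prog)
  | ite (b : Test) (p q : Prog)
  | loop (b : Test) (p : Prog)

/-- Overwriting one cell of one array. -/
def setCell {α : Type*} (f : ℕ → ℕ → ℕ → α) (a i j : ℕ) (v : α) : ℕ → ℕ → ℕ → α :=
  fun a' i' j' => if a' = a ∧ i' = i ∧ j' = j then v else f a' i' j'

/-- Effect of an elementary instruction. -/
noncomputable def Instr.apply : Instr → Mem → Mem
  | .nconst r k, s => { s with nreg := Function.update s.nreg r k }
  | .ncopy r r', s => { s with nreg := Function.update s.nreg r (s.nreg r') }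
  | .ninc r, s => { s with nreg := Function.update s.nreg r (s.nreg r + 1) }
  | .ndec r, s => { s with nreg := Function.update s.nreg r (s.nreg r - 1) }
  | .nload r a i j, s =>
      { s with nreg := Function.update s.nreg r (s.narr a (s.nreg i) (s.nreg j)) }
  | .nstore a i j r, s =>
      { s with narr := setCell s.narr a (s.nreg i) (s.nreg j) (s.nreg r) }
  | .rconst x q, s => { s with rreg := Function.update s.rreg x (q : ℝ) }
  | .rcopy x y, s => { s with rreg := Function.update s.rreg x (s.rreg y) }
  | .radd x y z, s => { s with rreg := Function.update s.rreg x (s.rreg y + s.rreg z) }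
  | .rsub x y z, s => { s with rreg := Function.update s.rreg x (s.rreg y - s.rreg z) }
  | .rload x a i j, s =>
      { s with rreg := Function.update s.rreg x (s.rarr a (s.nreg i) (s.nreg j)) }
  | .rstore a i j x, s =>
      { s with rarr := setCell s.rarr a (s.nreg i) (s.nreg j) (s.rreg x) }

/-- Truth of a test. -/
def Test.Holds : Test → Mem → Prop
  | .neq r r', s => s.nreg r = s.nreg r'
  | .nlt r r', s => s.nreg r < s.nreg r'
  | .rlt x y, s => s.rreg x < s.rreg y

/-- `Exec p s t s'`: started in memory `s`, the program `p` halts after exactly `t` steps in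
memory `s'`. -/
inductive Exec : Prog → Mem → ℕ → Mem → Prop
  | instr (c : Instr) (s : Mem) : Exec (.instr c) s 1 (c.apply s)
  | seq {p q : Prog} {s s' s'' : Mem} {t t' : ℕ} :
      Exec p s t s' → Exec q s' t' s'' → Exec (.seq p q) s (t + t') s''
  | iteTrue {b : Test} {p q : Prog} {s s' : Mem} {t : ℕ} :
      b.Holds s → Exec p s t s' → Exec (.ite b p q) s (t + 1) s'
  | iteFalse {b : Test} {p q : Prog} {s s' : Mem} {t : ℕ} :
      ¬ b.Holds s → Exec q s t s' → Exec (.ite b p q) s (t + 1) s'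
  | loopTrue {b : Test} {p : Prog} {s s' s'' : Mem} {t t' : ℕ} :
      b.Holds s → Exec p s t s' → Exec (.loop b p) s' t' s'' →
        Exec (.loop b p) s (t + t' + 1) s''
  | loopFalse {b : Test} {p : Prog} {s : Mem} :
      ¬ b.Holds s → Exec (.loop b p) s 1 s

/-- The machine is deterministic: running time and result are determined by the program and the
initial memory. -/
theorem Exec.deterministic {p : Prog} {s s₁ s₂ : Mem} {t₁ t₂ : ℕ}
    (h₁ : Exec p s t₁ s₁) (h₂ : Exec p s t₂ s₂) : t₁ = t₂ ∧ s₁ = s₂ := by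
  induction h₁ generalizing t₂ s₂ with
  | instr c s => cases h₂; exact ⟨rfl, rfl⟩
  | seq _ _ ih₁ ih₂ =>
    cases h₂ with
    | seq k₁ k₂ =>
      obtain ⟨rfl, rfl⟩ := ih₁ k₁
      obtain ⟨rfl, rfl⟩ := ih₂ k₂
      exact ⟨rfl, rfl⟩
  | iteTrue hb _ ih =>
    cases h₂ with
    | iteTrue _ k => obtain ⟨rfl, rfl⟩ := ih k; exact ⟨rfl, rfl⟩
    | iteFalse hb' _ => exact absurd hb hb'
  | iteFalse hb _ ih =>
    cases h₂ with
    | iteTrue hb' _ => exact absurd hb' hb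
    | iteFalse _ k => obtain ⟨rfl, rfl⟩ := ih k; exact ⟨rfl, rfl⟩
  | loopTrue hb _ _ ih₁ ih₂ =>
    cases h₂ with
    | loopTrue _ k₁ k₂ =>
      obtain ⟨rfl, rfl⟩ := ih₁ k₁
      obtain ⟨rfl, rfl⟩ := ih₂ k₂
      exact ⟨rfl, rfl⟩
    | loopFalse hb' => exact absurd hb hb'
  | loopFalse hb =>
    cases h₂ with
    | loopTrue hb' _ _ => exact absurd hb' hb
    | loopFalse _ => exact ⟨rfl, rfl⟩

/-- A finite matrix as the contents of an array, padded with `z`. -/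
def padded {α : Type*} {n k : ℕ} (z : α) (N : Fin n → Fin k → α) : ℕ → ℕ → α :=
  fun i j => if h : i < n ∧ j < k then N ⟨i, h.1⟩ ⟨j, h.2⟩ else z

/-- Initial memory: `d` and `m` in the registers `0` and `1`, the patterns of `A` and `B`
(`1` for `⋆`) in the arrays `0` and `1` of natural numbers, the costs `w` in the array `0` of
real numbers, and zero everywhere else. -/
noncomputable def inputMem {d m : ℕ} (A : SparsityMatrix d d) (B : SparsityMatrix d m)
    (w : Fin d → Fin m → ℝ) : Mem where
  nreg := fun r => if r = 0 then d else if r = 1 then m else 0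
  rreg := fun _ => 0
  narr := fun a =>
    if a = 0 then padded 0 fun i j => (A i j).toNat
    else if a = 1 then padded 0 fun i j => (B i j).toNat
    else fun _ _ => 0
  rarr := fun a => if a = 0 then padded 0 w else fun _ _ => 0

/-- The array `2` of natural numbers contains the pattern of `N`. -/
def Outputs {d m : ℕ} (s : Mem) (N : SparsityMatrix d m) : Prop :=
  ∀ (i : Fin d) (j : Fin m), s.narr 2 i j = (N i j).toNat

end StructCtrl

namespace StructCtrl

open Matrix

/-! ### Controllability of linear systems -/

/-! Optimality. In a controllable system a row vector `q` with `q A = 0` and `q B = 0` is zero,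
because `q · x(t)` is constant along trajectories. Hence no set of rows of the block matrix `(A B)`
can have fewer possibly nonzero columns than rows, and Hall's theorem gives a matching of `Γ(A,B')`
that saturates the right side for every admissible `B'`
(`StructurallyControllable.exists_injective`). Its input edges are connections of `B'`, so it costs
at most the weight of `B'`; it is also a maximum matching of `Γ(A,B)`, so `M*` costs no more.

Admissibility. The matching `M*` saturates the right side, and it uses an input because `Γ(A)` has
no perfect matching. Extended to a permutation of states and inputs, it splits the vertices into
paths starting in inputs and cycles of states. Such a system has to be given a controllable
realization. The criterion used is that no left eigenvector of `A` over the complex numbers is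
annihilated by `B` (`controllable_of_eigenvectors`, obtained from the Kalman criterion and an
explicit steering input). On the paths, weight `1` works: the entry at the start vanishes, and zeros
propagate along the path. The cycles are then attached one by one, each with one edge that enters it
from the part already treated; strong connectivity supplies this edge. A new cycle gets a weight `R
+ 1` so large that an eigenvector living on it has an eigenvalue beyond a bound `R` for the old
part. For such eigenvalues the old part tolerates the loss of one eigenvector equation, namely the
one perturbed by the new edge. This strengthened property is carried through the induction
(`PartialRealization.extend`), so no genericity argument is needed.

Algorithm. Filling the non-edges with a cost greater than that of any saturating matching turns the
task into an assignment problem with `d` rows and `d + m` columns, solved by the Hungarian method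
with potentials. `SearchTree.shift` and `SearchTree.grow` preserve the invariant of the search tree,
`Augmenting.step` that of the augmentation, and `DualPair.optimal` is the duality argument. A search
step is linear in `d + m`, inserting a row takes at most `d` such steps, and there are `d` rows. The
rules for `Runs` transfer correctness and step counts to the machine program. -/

/-- The function `q · x(t)` has derivative zero along every trajectory. Steering from `0` to `q`
itself therefore gives `q · q = 0`. -/
theorem Controllable.left_kernel {d m : ℕ} {A : Matrix (Fin d) (Fin d) ℝ}
    {B : Matrix (Fin d) (Fin m) ℝ} (h : Controllable A B) {q : Fin d → ℝ}
    (hA : q ᵥ* A = 0) (hB : q ᵥ* B = 0) : q = 0 := by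
  obtain ⟨T, hT, u, x, -, hx, h0, h1⟩ := h 0 q
  have hd : ∀ t ∈ Set.Icc 0 T, HasDerivWithinAt (fun t => q ⬝ᵥ x t) 0 (Set.Icc 0 T) t := by
    intro t ht
    have h2 : ∀ i ∈ Finset.univ, HasDerivWithinAt (fun t => q i * x t i)
        (q i * (A *ᵥ x t + B *ᵥ u t) i) (Set.Icc 0 T) t := fun i _ =>
      (hasDerivWithinAt_pi.1 (hx t ht) i).const_mul (q i)
    have h3 := HasDerivWithinAt.fun_sum h2
    have h4 : ∑ i, q i * (A *ᵥ x t + B *ᵥ u t) i = 0 := by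
      change q ⬝ᵥ (A *ᵥ x t + B *ᵥ u t) = 0
      rw [dotProduct_add, dotProduct_mulVec, dotProduct_mulVec, hA, hB]
      simp
    rw [h4] at h3
    exact h3
  have hc := constant_of_has_deriv_right_zero (a := (0 : ℝ)) (b := T) (f := fun t => q ⬝ᵥ x t)
    (fun t ht => (hd t ht).continuousWithinAt) (fun t ht => by
      have h5 := hd t (Set.Ico_subset_Icc_self ht)
      exact (h5.mono_of_mem_nhdsWithin (Icc_mem_nhdsGE_of_mem ht))) T (Set.right_mem_Icc.2 hT.le)
  simp only [h0, h1, dotProduct_zero] at hc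
  exact dotProduct_self_eq_zero.1 hc

theorem exp_neg_mul_exp {E : Type*} [NormedAddCommGroup E] [NormedSpace ℝ E] [CompleteSpace E]
    (X : E →L[ℝ] E) : NormedSpace.exp (-X) * NormedSpace.exp X = 1 := by
  let _ : NormedAlgebra ℚ (E →L[ℝ] E) := NormedAlgebra.restrictScalars ℚ ℝ _
  rw [← NormedSpace.exp_add_of_commute (Commute.refl X).neg_left, neg_add_cancel,
    NormedSpace.exp_zero]

theorem exp_mul_exp_neg {E : Type*} [NormedAddCommGroup E] [NormedSpace ℝ E] [CompleteSpace E]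
    (X : E →L[ℝ] E) : NormedSpace.exp X * NormedSpace.exp (-X) = 1 := by
  simpa using exp_neg_mul_exp (-X)

theorem continuous_exp_smul {E : Type*} [NormedAddCommGroup E] [NormedSpace ℝ E]
    [CompleteSpace E] (L : E →L[ℝ] E) :
    Continuous fun t : ℝ => NormedSpace.exp (t • L) :=
  continuous_iff_continuousAt.2 fun t => (hasDerivAt_exp_smul_const L t).continuousAt

/-- If a functional annihilates `exp (-sL) β` for all `s` in an open interval, then it annihilates
all `exp (-sL) Lᵏ β` there. -/
theorem functional_exp_pow {E F : Type*} [NormedAddCommGroup E] [NormedSpace ℝ E]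
    [CompleteSpace E] [NormedAddCommGroup F] [NormedSpace ℝ F] (L : E →L[ℝ] E) (β : F →L[ℝ] E)
    (φ : E →L[ℝ] ℝ)
    (h : ∀ s ∈ Set.Ioo (0 : ℝ) 1, ∀ y, φ (NormedSpace.exp (s • -L) (β y)) = 0) (k : ℕ) :
    ∀ s ∈ Set.Ioo (0 : ℝ) 1, ∀ y, φ (NormedSpace.exp (s • -L) ((L ^ k) (β y))) = 0 := by
  induction k with
  | zero => simpa using h
  | succ k ih =>
    intro s hs y
    have h1 : HasDerivAt (fun s : ℝ => φ (NormedSpace.exp (s • -L) ((L ^ k) (β y))))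
        (φ ((NormedSpace.exp (s • -L) * -L) ((L ^ k) (β y)))) s :=
      φ.hasFDerivAt.comp_hasDerivAt s
        ((hasDerivAt_exp_smul_const (-L) s).clm_apply (hasDerivAt_const s _) |>.congr_deriv
          (by simp))
    have h2 : HasDerivAt (fun s : ℝ => φ (NormedSpace.exp (s • -L) ((L ^ k) (β y)))) 0 s := by
      refine (hasDerivAt_const s (0 : ℝ)).congr_of_eventuallyEq ?_
      filter_upwards [isOpen_Ioo.mem_nhds hs] with r hr using ih r hr y
    have h3 := h1.unique h2
    rw [pow_succ']
    simpa using h3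

/-- Were the range of this linear map a proper subspace, some nonzero functional `φ` would vanish on
it. Testing `φ` with the input `s ↦ φ (exp (-sL) β ·)` makes the integral of a square vanish, so `φ`
annihilates `exp (-sL) β` on the open interval; differentiation brings in the powers of `L`. -/
theorem exists_integral_eq {E : Type*} [NormedAddCommGroup E] [NormedSpace ℝ E]
    [FiniteDimensional ℝ E] {m : ℕ} (L : E →L[ℝ] E) (β : (Fin m → ℝ) →L[ℝ] E)
    (h : ∀ φ : E →L[ℝ] ℝ, (∀ k y, φ ((L ^ k) (β y)) = 0) → φ = 0) (z : E) :
    ∃ u : C(ℝ, Fin m → ℝ), ∫ s in (0 : ℝ)..1, NormedSpace.exp (s • -L) (β (u s)) = z := by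
  have : CompleteSpace E := FiniteDimensional.complete ℝ E
  have hcont : ∀ u : C(ℝ, Fin m → ℝ),
      Continuous fun s : ℝ => NormedSpace.exp (s • -L) (β (u s)) := fun u =>
    (continuous_exp_smul (-L)).clm_apply (β.continuous.comp u.continuous)
  let F : C(ℝ, Fin m → ℝ) →ₗ[ℝ] E :=
    { toFun := fun u => ∫ s in (0 : ℝ)..1, NormedSpace.exp (s • -L) (β (u s))
      map_add' := fun u v => by
        rw [← intervalIntegral.integral_add ((hcont u).intervalIntegrable _ _)
          ((hcont v).intervalIntegrable _ _)]
        simp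
      map_smul' := fun c u => by
        rw [RingHom.id_apply, ← intervalIntegral.integral_smul]
        simp }
  suffices hF : LinearMap.range F = ⊤ from LinearMap.range_eq_top.1 hF z
  by_contra hne
  obtain ⟨f, hf0, hf⟩ := Submodule.exists_le_ker_of_lt_top _ (lt_top_iff_ne_top.2 hne)
  let φ : E →L[ℝ] ℝ := LinearMap.toContinuousLinearMap f
  have hφ0 : φ ≠ 0 := fun h0 => hf0 (by
    ext x
    exact DFunLike.congr_fun h0 x)
  have hφF : ∀ u, φ (F u) = 0 := fun u => hf (LinearMap.mem_range_self F u)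
  -- The input that represents `φ ∘ F`: applying `φ` to the integrand for `u` gives the dot product
  -- of `u` and `g`.
  let g : C(ℝ, Fin m → ℝ) :=
    ⟨fun s j => φ (NormedSpace.exp (s • -L) (β (Pi.single j 1))),
      continuous_pi fun j => φ.continuous.comp
        ((continuous_exp_smul (-L)).clm_apply continuous_const)⟩
  have hlin : ∀ s (y : Fin m → ℝ), φ (NormedSpace.exp (s • -L) (β y)) = ∑ j, y j * g s j := by
    intro s y
    conv_lhs => rw [pi_eq_sum_univ' y]
    simp only [map_sum, map_smul, smul_eq_mul]
    rfl
  have hint : ∫ s in (0 : ℝ)..1, ∑ j, g s j * g s j = 0 := by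
    have h0 := hφF g
    change φ (∫ s in (0 : ℝ)..1, NormedSpace.exp (s • -L) (β (g s))) = 0 at h0
    rw [← ContinuousLinearMap.intervalIntegral_comp_comm φ ((hcont g).intervalIntegrable _ _)] at h0
    simpa only [hlin] using h0
  have hgc : Continuous fun s => ∑ j, g s j * g s j := by fun_prop
  have hg0 : ∀ s ∈ Set.Ioo (0 : ℝ) 1, ∀ j, g s j = 0 := by
    intro s hs
    have h0 : ∑ j, g s j * g s j = 0 := by
      by_contra hs0
      have hpos : 0 < ∑ j, g s j * g s j :=
        lt_of_le_of_ne (Finset.sum_nonneg fun j _ => mul_self_nonneg _) (Ne.symm hs0)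
      have := intervalIntegral.integral_pos (a := (0 : ℝ)) (b := 1) zero_lt_one hgc.continuousOn
        (fun s _ => Finset.sum_nonneg fun j _ => mul_self_nonneg _)
        ⟨s, Set.Ioo_subset_Icc_self hs, hpos⟩
      linarith
    intro j
    exact mul_self_eq_zero.1
      ((Finset.sum_eq_zero_iff_of_nonneg fun j _ => mul_self_nonneg _).1 h0 j (Finset.mem_univ j))
  have hk := functional_exp_pow L β φ (fun s hs y => by
    rw [hlin]; exact Finset.sum_eq_zero fun j _ => by rw [hg0 s hs j, mul_zero])
  -- Any interior point would do. The hypothesis is applied to `φ ∘ exp (-L/2)`, and invertibility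
  -- of the exponential returns `φ = 0`.
  have hhalf : (1 / 2 : ℝ) ∈ Set.Ioo (0 : ℝ) 1 := by constructor <;> norm_num
  have hz := h (φ.comp (NormedSpace.exp ((1 / 2 : ℝ) • -L))) (fun k y => hk k _ hhalf y)
  apply hφ0
  ext x
  have h6 := DFunLike.congr_fun hz (NormedSpace.exp ((1 / 2 : ℝ) • L) x)
  have h7 := exp_neg_mul_exp ((1 / 2 : ℝ) • L)
  rw [← smul_neg] at h7
  have h8 := DFunLike.congr_fun h7 x
  simp only [mul_apply_eq_comp, one_apply_eq_self] at h8
  rw [ContinuousLinearMap.comp_apply, h8] at h6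
  exact h6

/-- The Kalman criterion implies controllability. -/
theorem controllable_of_kalman {d m : ℕ} {A : Matrix (Fin d) (Fin d) ℝ}
    {B : Matrix (Fin d) (Fin m) ℝ}
    (h : ∀ q : Fin d → ℝ, (∀ k : ℕ, q ᵥ* (A ^ k * B) = 0) → q = 0) : Controllable A B := by
  intro x₀ x₁
  let L : (Fin d → ℝ) →L[ℝ] (Fin d → ℝ) := LinearMap.toContinuousLinearMap (Matrix.mulVecLin A)
  let β : (Fin m → ℝ) →L[ℝ] (Fin d → ℝ) := LinearMap.toContinuousLinearMap (Matrix.mulVecLin B)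
  have hL : ∀ x, L x = A *ᵥ x := fun x => rfl
  have hβ : ∀ x, β x = B *ᵥ x := fun x => rfl
  have hpow : ∀ k x, (L ^ k) x = A ^ k *ᵥ x := by
    intro k
    induction k with
    | zero => simp
    | succ k ih => intro x; rw [pow_succ', pow_succ', mul_apply_eq_comp, ih, hL,
        mulVec_mulVec]
  obtain ⟨u, hu⟩ := exists_integral_eq L β (by
    intro φ hφ
    have hrep : ∀ x, φ x = (fun i => φ (Pi.single i 1)) ⬝ᵥ x := by
      intro x
      conv_lhs => rw [pi_eq_sum_univ' x]
      simp only [map_sum, map_smul, smul_eq_mul, dotProduct]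
      exact Finset.sum_congr rfl fun i _ => mul_comm _ _
    have h0 := h (fun i => φ (Pi.single i 1)) (fun k => by
      funext j
      have := hφ k (Pi.single j 1)
      rw [hβ, hpow, hrep, mulVec_mulVec, dotProduct_mulVec] at this
      simpa using this)
    ext x
    rw [hrep, h0]
    simp) (NormedSpace.exp (-L) x₁ - x₀)
  have hcont : Continuous fun s : ℝ => NormedSpace.exp (s • -L) (β (u s)) :=
    (continuous_exp_smul (-L)).clm_apply (β.continuous.comp u.continuous)
  -- Variation of constants on `[0, 1]`; `u` was chosen so that the integral up to time `1` equals
  -- `exp (-L) x₁ - x₀`.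
  refine ⟨1, one_pos, u, fun t => NormedSpace.exp (t • L)
    (x₀ + ∫ s in (0 : ℝ)..t, NormedSpace.exp (s • -L) (β (u s))), u.continuous.continuousOn,
    ?_, ?_, ?_⟩
  · intro t _
    have h1 : HasDerivAt (fun t : ℝ => x₀ + ∫ s in (0 : ℝ)..t, NormedSpace.exp (s • -L) (β (u s)))
        (NormedSpace.exp (t • -L) (β (u t))) t :=
      (hcont.integral_hasStrictDerivAt 0 t).hasDerivAt.const_add x₀
    have h2 := (hasDerivAt_exp_smul_const' (𝕂 := ℝ) L t).clm_apply h1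
    refine (h2.congr_deriv ?_).hasDerivWithinAt
    have h7 := exp_mul_exp_neg (t • L)
    rw [← smul_neg] at h7
    have h8 := DFunLike.congr_fun h7 (β (u t))
    simp only [mul_apply_eq_comp, one_apply_eq_self] at h8
    rw [h8]
    rfl
  · simp
  · have h7 := DFunLike.congr_fun (exp_mul_exp_neg L) x₁
    simp only [mul_apply_eq_comp, one_apply_eq_self] at h7
    simp only [one_smul, hu, add_sub_cancel, h7]

/-- The eigenvector criterion, over the complex numbers, implies controllability. -/
theorem controllable_of_eigenvectors {d m : ℕ} {A : Matrix (Fin d) (Fin d) ℝ}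
    {B : Matrix (Fin d) (Fin m) ℝ}
    (h : ∀ (z : ℂ) (q : Fin d → ℂ), q ᵥ* A.map Complex.ofReal = z • q → q ᵥ* B.map Complex.ofReal = 0 → q = 0) :
    Controllable A B := by
  apply controllable_of_kalman
  intro q hq
  by_contra hq0
  let Ac : Matrix (Fin d) (Fin d) ℂ := A.map Complex.ofReal
  let Bc : Matrix (Fin d) (Fin m) ℂ := B.map Complex.ofReal
  -- The complexified uncontrollable directions. They form a space invariant under right
  -- multiplication by `A`, so if it is nonzero it contains a left eigenvector, and the term `k = 0`
  -- says that `B` annihilates it.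
  let W : Submodule ℂ (Fin d → ℂ) :=
    ⨅ k : ℕ, LinearMap.ker (Matrix.vecMulLinear (Ac ^ k * Bc))
  have hW : ∀ x, x ∈ W ↔ ∀ k : ℕ, x ᵥ* (Ac ^ k * Bc) = 0 := by
    intro x; simp [W, Submodule.mem_iInf]
  have hinv : ∀ x ∈ W, Matrix.vecMulLinear Ac x ∈ W := by
    intro x hx
    rw [hW] at hx ⊢
    intro k
    have := hx (k + 1)
    rwa [pow_succ', Matrix.mul_assoc, ← vecMul_vecMul] at this
  have hqW : (fun i => (q i : ℂ)) ∈ W := by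
    rw [hW]
    intro k
    have h1 : (Ac ^ k * Bc)
        = (A ^ k * B).map (Complex.ofRealHom) := by
      rw [Matrix.map_mul, Matrix.map_pow]; rfl
    rw [h1]
    funext j
    have h2 := congrArg (Complex.ofRealHom) (congrFun (hq k) j)
    simpa [vecMul, dotProduct] using h2
  have hnt : Nontrivial W := ⟨⟨⟨_, hqW⟩, 0, fun h0 => hq0 (by
    funext i
    have := congrFun (congrArg Subtype.val h0) i
    simpa using this)⟩⟩
  obtain ⟨z, hz⟩ := Module.End.exists_eigenvalue
    ((Matrix.vecMulLinear Ac).restrict hinv)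
  obtain ⟨⟨x, hxW⟩, hx⟩ := hz.exists_hasEigenvector
  apply hx.2
  apply Subtype.ext
  refine h z x ?_ ?_
  · have := congrArg Subtype.val hx.apply_eq_smul
    simpa using this
  · have := (hW x).1 hxW 0
    simpa using this

end StructCtrl

namespace StructCtrl

open Matrix

/-! ### Structural controllability and matchings -/

theorem mem_gammaAB_inl {d m : ℕ} {A : SparsityMatrix d d} {B : SparsityMatrix d m}
    {i j : Fin d} : (Sum.inl j, i) ∈ gammaAB A B ↔ A i j = true := by simp [gammaAB]

theorem mem_gammaAB_inr {d m : ℕ} {A : SparsityMatrix d d} {B : SparsityMatrix d m}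
    {i : Fin d} {j : Fin m} : (Sum.inr j, i) ∈ gammaAB A B ↔ B i j = true := by simp [gammaAB]

/-- In a structurally controllable system the right side of `Γ(A,B)` can be saturated. -/
theorem StructurallyControllable.exists_injective {d m : ℕ} {A : SparsityMatrix d d}
    {B : SparsityMatrix d m} (h : StructurallyControllable A B) :
    ∃ σ : Fin d → Fin d ⊕ Fin m, Function.Injective σ ∧ ∀ i, (σ i, i) ∈ gammaAB A B := by
  obtain ⟨A', B', hA, hB, hc⟩ := h
  let t : Fin d → Finset (Fin d ⊕ Fin m) := fun i =>
    Finset.univ.filter fun x => (x, i) ∈ gammaAB A B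
  suffices hall : ∀ s : Finset (Fin d), s.card ≤ (s.biUnion t).card by
    obtain ⟨σ, hσ, hσt⟩ := (Finset.all_card_le_biUnion_card_iff_exists_injective t).1 hall
    exact ⟨σ, hσ, fun i => by simpa [t] using hσt i⟩
  intro s
  by_contra! hlt
  let N : Matrix (Fin d) (Fin d ⊕ Fin m) ℝ := Matrix.fromCols A' B'
  have hN : ∀ i x, x ∉ t i → N i x = 0 := by
    rintro i (j | j) hx
    · simp only [t, Finset.mem_filter, Finset.mem_univ, true_and, mem_gammaAB_inl,
        Bool.not_eq_true] at hx
      exact hA i j hx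
    · simp only [t, Finset.mem_filter, Finset.mem_univ, true_and, mem_gammaAB_inr,
        Bool.not_eq_true] at hx
      exact hB i j hx
  -- The rows in `s` meet fewer than `s.card` possibly nonzero columns, so they are linearly
  -- dependent; the relation, extended by zero, is a left null vector of `(A B)`.
  let f := Matrix.vecMulLinear (N.submatrix (Subtype.val : s → Fin d)
    (Subtype.val : s.biUnion t → Fin d ⊕ Fin m))
  have hker := LinearMap.ker_ne_bot_of_finrank_lt (f := f) (by
    rw [Module.finrank_fintype_fun_eq_card, Module.finrank_fintype_fun_eq_card, Fintype.card_coe,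
      Fintype.card_coe]
    exact hlt)
  obtain ⟨q, hq, hq0⟩ := (Submodule.ne_bot_iff _).1 hker
  let q' : Fin d → ℝ := fun i => if h : i ∈ s then q ⟨i, h⟩ else 0
  have hq' : ∀ x, (q' ᵥ* N) x = 0 := by
    intro x
    have hsum : (q' ᵥ* N) x = ∑ i : s, q i * N i x := by
      simp only [vecMul, dotProduct]
      rw [← Finset.sum_subset (Finset.subset_univ s) (fun i _ hi => by simp [q', hi]),
        ← Finset.sum_coe_sort]
      exact Finset.sum_congr rfl fun i _ => by simp [q']
    rw [hsum]
    by_cases hx : x ∈ s.biUnion t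
    · exact congrFun (LinearMap.mem_ker.1 hq) ⟨x, hx⟩
    · refine Finset.sum_eq_zero fun i _ => ?_
      rw [hN i x fun hi => hx (Finset.mem_biUnion.2 ⟨i, i.2, hi⟩), mul_zero]
  have h0 : q' = 0 := hc.left_kernel (funext fun j => hq' (Sum.inl j))
    (funext fun j => hq' (Sum.inr j))
  apply hq0
  funext i
  have := congrFun h0 i
  simpa [q'] using this

/-- This turns a saturating matching into cycles. Since `σ i` is the predecessor of the state `i`,
`τ` runs against the edges and `τ.symm` along them; cycles that meet an input are made of paths
starting in inputs. -/
theorem exists_perm_extending {d m : ℕ} {σ : Fin d → Fin d ⊕ Fin m}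
    (hσ : Function.Injective σ) :
    ∃ τ : Equiv.Perm (Fin d ⊕ Fin m), ∀ i, τ (Sum.inl i) = σ i := by
  let e₁ : {x : Fin d ⊕ Fin m // x ∈ Set.range (Sum.inl : Fin d → Fin d ⊕ Fin m)} ≃ Fin d :=
    (Equiv.ofInjective _ Sum.inl_injective).symm
  let e := e₁.trans (Equiv.ofInjective σ hσ)
  refine ⟨e.extendSubtype, fun i => ?_⟩
  rw [Equiv.extendSubtype_apply_of_mem e _ ⟨i, rfl⟩]
  have : e₁ ⟨Sum.inl i, ⟨i, rfl⟩⟩ = i :=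
    (Equiv.ofInjective _ Sum.inl_injective).symm_apply_eq.2 (by ext1; simp)
  simp [e, this]

theorem zero_of_sameCycle {X : Type*} [Finite X] {τ : Equiv.Perm X} {f : X → ℂ}
    (h : ∀ x, f x = 0 → f (τ.symm x) = 0) {x y : X} (hxy : τ.SameCycle x y) (hx : f x = 0) :
    f y = 0 := by
  obtain ⟨n, hn⟩ := (Equiv.Perm.sameCycle_inv.2 hxy).exists_nat_pow_eq
  have : ∀ n : ℕ, f (((τ⁻¹ : Equiv.Perm X) ^ n) x) = 0 := by
    intro n
    induction n with
    | zero => simpa using hx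
    | succ n ih =>
      rw [pow_succ', Equiv.Perm.mul_apply]
      exact h _ ih
  rw [← hn]
  exact this n

/-- A set of zeros that is invariant under a permutation except possibly at one point is
invariant. -/
theorem zero_iff_of_except {X : Type*} [Fintype X] {τ : Equiv.Perm X} {f : X → ℂ} (p : X)
    (h : ∀ x, x ≠ p → (f x = 0 ↔ f (τ.symm x) = 0)) (x : X) : f x = 0 ↔ f (τ.symm x) = 0 := by
  classical
  by_cases hx : x = p
  swap
  · exact h x hx
  subst hx
  -- `f` and `f ∘ τ.symm` have equally many zeros. All terms other than the one at `x` agree, so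
  -- this one agrees too.
  have h1 : (∑ y, if f y = 0 then (1 : ℕ) else 0) = ∑ y, if f (τ.symm y) = 0 then 1 else 0 :=
    (Equiv.sum_comp τ.symm fun y => if f y = 0 then (1 : ℕ) else 0).symm
  rw [← Finset.add_sum_erase _ _ (Finset.mem_univ x),
    ← Finset.add_sum_erase Finset.univ _ (Finset.mem_univ x)] at h1
  rw [Finset.sum_congr rfl (g := fun y => if f (τ.symm y) = 0 then (1 : ℕ) else 0)
    fun y hy => by rw [if_congr (h y (Finset.ne_of_mem_erase hy)) rfl rfl]] at h1
  have h2 := Nat.add_right_cancel h1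
  split_ifs at h2 with ha hb hb <;> simp_all

/-- Summing norms over all points gives `a ∑ ‖f‖ = ‖z‖ ∑ ‖f‖`, since the permutation does not change
the sum. -/
theorem zero_of_norm_ne {X : Type*} [Fintype X] {τ : Equiv.Perm X} {f : X → ℂ} {a : ℝ} {z : ℂ}
    (ha : 0 ≤ a) (haz : ‖z‖ ≠ a) (h : ∀ x, (a : ℂ) * f (τ.symm x) = z * f x) (x : X) :
    f x = 0 := by
  have h1 : a * ∑ y, ‖f y‖ = ‖z‖ * ∑ y, ‖f y‖ := by
    calc a * ∑ y, ‖f y‖ = a * ∑ y, ‖f (τ.symm y)‖ := by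
          rw [Equiv.sum_comp τ.symm fun y => ‖f y‖]
      _ = ∑ y, ‖(a : ℂ) * f (τ.symm y)‖ := by
          rw [Finset.mul_sum]; simp [abs_of_nonneg ha]
      _ = ‖z‖ * ∑ y, ‖f y‖ := by rw [Finset.mul_sum]; simp [h]
  have h2 : ∑ y, ‖f y‖ = 0 := by
    by_contra h0
    exact haz (mul_right_cancel₀ h0 h1).symm
  simpa using (Finset.sum_eq_zero_iff_of_nonneg fun y _ => norm_nonneg (f y)).1 h2 x
    (Finset.mem_univ x)

/-! ### Construction of a controllable realization from a permutation -/

section Realization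

open scoped Classical

variable {d m : ℕ}

/-- The edges `τ x → x` inside `C`, with weight `a`. -/
noncomputable def cycleMatrix (τ : Equiv.Perm (Fin d ⊕ Fin m)) (C : Set (Fin d ⊕ Fin m)) (a : ℝ) :
    Matrix (Fin d) (Fin d) ℝ :=
  fun i j => if Sum.inl i ∈ C ∧ τ (Sum.inl i) = Sum.inl j then a else 0

/-- Column `j` has at most one nonzero entry, in the row `τ⁻¹ j`. Extending `q` by zero to the
inputs covers the case that `τ⁻¹ j` is an input, where the column is zero. -/
theorem sum_mul_cycleMatrix (τ : Equiv.Perm (Fin d ⊕ Fin m)) {C : Set (Fin d ⊕ Fin m)}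
    (hC : ∀ x, x ∈ C ↔ τ x ∈ C) (a : ℝ) (q : Fin d → ℂ) (j : Fin d) :
    ∑ i, q i * (cycleMatrix τ C a i j : ℂ) =
      if Sum.inl j ∈ C then (a : ℂ) * Sum.elim q 0 (τ.symm (Sum.inl j)) else 0 := by
  have hx : τ (τ.symm (Sum.inl j)) = Sum.inl j := by simp
  generalize τ.symm (Sum.inl j) = x at hx
  rcases x with i | i
  · rw [Finset.sum_eq_single i]
    · simp only [cycleMatrix, hx, hC (Sum.inl i)]
      split_ifs <;> simp_all [mul_comm]
    · intro i' _ hi'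
      rw [cycleMatrix, if_neg, Complex.ofReal_zero, mul_zero]
      rintro ⟨-, h⟩
      exact hi' (Sum.inl_injective (τ.injective (h.trans hx.symm)))
    · simp
  · rw [Finset.sum_eq_zero]
    · simp
    · intro i' _
      rw [cycleMatrix, if_neg, Complex.ofReal_zero, mul_zero]
      rintro ⟨-, h⟩
      cases τ.injective (h.trans hx.symm)

/-- A realization of `A` on the vertices in `S` that satisfies the eigenvector criterion when the
inputs are connected as in `τ`, also if the eigenvector equation of one vertex is dropped,
provided that the eigenvalue is large. -/
structure PartialRealization (A : SparsityMatrix d d) (τ : Equiv.Perm (Fin d ⊕ Fin m))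
    (S : Set (Fin d ⊕ Fin m)) (A' : Matrix (Fin d) (Fin d) ℝ) : Prop where
  isRealization : IsRealization A A'
  support : ∀ i j, Sum.inl i ∉ S ∨ Sum.inl j ∉ S → A' i j = 0
  eigen : ∀ (z : ℂ) (q : Fin d → ℂ), (∀ i, Sum.inl i ∉ S → q i = 0) →
    (∀ i j, τ (Sum.inl i) = Sum.inr j → q i = 0) →
    (∀ j, Sum.inl j ∈ S → ∑ i, q i * (A' i j : ℂ) = z * q j) → q = 0
  eigen_except : ∃ R : ℝ, 0 ≤ R ∧ ∀ z : ℂ, R < ‖z‖ → ∀ (p : Fin d) (q : Fin d → ℂ),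
    Sum.inl p ∈ S → (∀ i, Sum.inl i ∉ S → q i = 0) →
    (∀ i j, τ (Sum.inl i) = Sum.inr j → q i = 0) →
    (∀ j, j ≠ p → Sum.inl j ∈ S → ∑ i, q i * (A' i j : ℂ) = z * q j) → q = 0

theorem elim_symm_inr {τ : Equiv.Perm (Fin d ⊕ Fin m)} {q : Fin d → ℂ}
    (hq : ∀ i j, τ (Sum.inl i) = Sum.inr j → q i = 0) (j : Fin m) :
    Sum.elim q (0 : Fin m → ℂ) (τ.symm (Sum.inr j)) = 0 := by
  have hx : τ (τ.symm (Sum.inr j)) = Sum.inr j := by simp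
  generalize τ.symm (Sum.inr j) = x at hx
  rcases x with i | i
  · exact hq i j hx
  · rfl

/-- The cycles through the inputs, that is, the paths that start in an input. -/
theorem partialRealization_stems {A : SparsityMatrix d d} {τ : Equiv.Perm (Fin d ⊕ Fin m)}
    (hτ : ∀ i j, τ (Sum.inl i) = Sum.inl j → A i j = true)
    {S : Set (Fin d ⊕ Fin m)} (hS : ∀ x, x ∈ S ↔ τ x ∈ S)
    (hin : ∀ x ∈ S, ∃ j, τ.SameCycle (Sum.inr j) x) :
    PartialRealization A τ S (cycleMatrix τ S 1) := by
  have hS' : ∀ x, x ∈ S ↔ τ.symm x ∈ S := fun x => by rw [hS (τ.symm x)]; simp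
  -- Every vertex of `S` shares a cycle with an input, where the extended vector is zero, so
  -- propagation of zeros suffices.
  have hzero : ∀ q : Fin d → ℂ, (∀ i, Sum.inl i ∉ S → q i = 0) →
      (∀ x, Sum.elim q (0 : Fin m → ℂ) x = 0 → Sum.elim q (0 : Fin m → ℂ) (τ.symm x) = 0) →
      q = 0 := by
    intro q hq h
    funext i
    by_cases hi : Sum.inl i ∈ S
    · obtain ⟨j, hj⟩ := hin _ hi
      exact zero_of_sameCycle h hj rfl
    · exact hq i hi
  have hout : ∀ q : Fin d → ℂ, (∀ i, Sum.inl i ∉ S → q i = 0) → ∀ x, x ∉ S →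
      Sum.elim q (0 : Fin m → ℂ) x = 0 := by
    rintro q hq (i | i) hx
    · exact hq i hx
    · rfl
  refine ⟨?_, ?_, ?_, 0, le_rfl, ?_⟩
  · intro i j hij
    rw [cycleMatrix, if_neg]
    rintro ⟨-, h⟩
    simp [hτ i j h] at hij
  · intro i j hij
    rw [cycleMatrix, if_neg]
    rintro ⟨h, h'⟩
    rw [← h', ← hS] at hij
    tauto
  · intro z q hq hB hA
    refine hzero q hq ?_
    rintro (j | j) hx
    · by_cases hj : Sum.inl j ∈ S
      · have := hA j hj
        rw [sum_mul_cycleMatrix τ hS, if_pos hj, Complex.ofReal_one, one_mul] at this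
        rw [this]
        simp only [Sum.elim_inl] at hx
        rw [hx, mul_zero]
      · exact hout q hq _ (fun h => hj ((hS' _).2 h))
    · exact elim_symm_inr hB j
  · intro z hz p q _ hq hB hA
    have hz0 : z ≠ 0 := norm_pos_iff.1 hz
    -- For `z ≠ 0` each eigenvector equation transports zeros in both directions, and counting zeros
    -- replaces the equation missing at `p`.
    refine hzero q hq fun x => (zero_iff_of_except (Sum.inl p) ?_ x).1
    rintro (j | j) hx
    · by_cases hj : Sum.inl j ∈ S
      · have := hA j (fun h => hx (h ▸ rfl)) hj
        rw [sum_mul_cycleMatrix τ hS, if_pos hj, Complex.ofReal_one, one_mul] at this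
        rw [this]
        simp [hz0]
      · rw [hout q hq _ hj, hout q hq _ (fun h => hj ((hS' _).2 h))]
    · rw [elim_symm_inr hB j]
      simp

/-- Adding a cycle and an edge that enters it. -/
theorem PartialRealization.extend {A : SparsityMatrix d d} {τ : Equiv.Perm (Fin d ⊕ Fin m)}
    {S C : Set (Fin d ⊕ Fin m)} {A' : Matrix (Fin d) (Fin d) ℝ}
    (h : PartialRealization A τ S A')
    (hτ : ∀ i j, τ (Sum.inl i) = Sum.inl j → A i j = true)
    (hinr : ∀ j, Sum.inr j ∈ S) (hC : ∀ x, x ∈ C ↔ τ x ∈ C)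
    (hdisj : ∀ x ∈ C, x ∉ S) {p c : Fin d} (hp : Sum.inl p ∈ S) (hc : Sum.inl c ∈ C)
    (hcyc : ∀ x ∈ C, τ.SameCycle (Sum.inl c) x) (hpc : A c p = true) :
    ∃ A'', PartialRealization A τ (S ∪ C) A'' := by
  have hC' : ∀ x, x ∈ C ↔ τ.symm x ∈ C := fun x => by rw [hC (τ.symm x)]; simp
  obtain ⟨R, hR, hex⟩ := h.eigen_except
  have ha : (0 : ℝ) < R + 1 := by linarith
  have ha' : ((R + 1 : ℝ) : ℂ) ≠ 0 := Complex.ofReal_ne_zero.2 ha.ne'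
  have hpC : Sum.inl p ∉ C := fun h' => hdisj _ h' hp
  -- The cycle gets weight `R + 1`, just above the threshold of the old part. The new edge `p → c`
  -- is the entry `(c, p)`: it changes only the equation at `p`, not those on the cycle.
  let A'' : Matrix (Fin d) (Fin d) ℝ := fun i j =>
    A' i j + cycleMatrix τ C (R + 1) i j + if i = c ∧ j = p then 1 else 0
  -- The restrictions of an eigenvector to the old part `S` and to the new cycle `C`.
  let r : (Fin d → ℂ) → Fin d → ℂ := fun q i => if Sum.inl i ∈ S then q i else 0
  let f : (Fin d → ℂ) → Fin d ⊕ Fin m → ℂ := fun q x => if x ∈ C then Sum.elim q 0 x else 0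
  have hsum : ∀ (q : Fin d → ℂ) j, ∑ i, q i * (A'' i j : ℂ) =
      ∑ i, q i * (A' i j : ℂ) +
      (if Sum.inl j ∈ C then ((R + 1 : ℝ) : ℂ) * Sum.elim q 0 (τ.symm (Sum.inl j)) else 0) +
      if j = p then q c else 0 := by
    intro q j
    rw [← sum_mul_cycleMatrix τ hC, ← Finset.sum_add_distrib]
    have : (if j = p then q c else 0) =
        ∑ i, q i * ((if i = c ∧ j = p then 1 else 0 : ℝ) : ℂ) := by
      by_cases hj : j = p <;> simp [hj, apply_ite]
    rw [this, ← Finset.sum_add_distrib]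
    refine Finset.sum_congr rfl fun i _ => ?_
    simp only [A'', Complex.ofReal_add]
    ring
  have hsumS : ∀ (q : Fin d → ℂ) j, Sum.inl j ∈ S → ∑ i, q i * (A'' i j : ℂ) =
      ∑ i, r q i * (A' i j : ℂ) + if j = p then q c else 0 := by
    intro q j hj
    rw [hsum, if_neg (fun h' => hdisj _ h' hj), add_zero]
    congr 1
    refine Finset.sum_congr rfl fun i _ => ?_
    by_cases hi : Sum.inl i ∈ S
    · simp [r, hi]
    · simp [h.support i j (Or.inl hi)]
  have hsumC : ∀ (q : Fin d → ℂ) j, Sum.inl j ∈ C → ∑ i, q i * (A'' i j : ℂ) =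
      ((R + 1 : ℝ) : ℂ) * f q (τ.symm (Sum.inl j)) := by
    intro q j hj
    rw [hsum, if_pos hj, if_neg (by rintro rfl; exact hpC hj), add_zero, Finset.sum_eq_zero, zero_add]
    · simp only [f, if_pos ((hC' _).1 hj)]
    · intro i _
      simp [h.support i j (Or.inr (hdisj _ hj))]
  have hrS : ∀ q : Fin d → ℂ, ∀ i, Sum.inl i ∉ S → r q i = 0 := fun q i hi => by simp [r, hi]
  have hrB : ∀ q : Fin d → ℂ, (∀ i j, τ (Sum.inl i) = Sum.inr j → q i = 0) →
      (∀ i j, τ (Sum.inl i) = Sum.inr j → r q i = 0) := fun q hq i j hij => by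
    simp [r, hq i j hij]
  have hrj : ∀ (q : Fin d → ℂ) j, Sum.inl j ∈ S → q j = r q j := fun q j hj => by simp [r, hj]
  have hfc : ∀ q, f q (Sum.inl c) = q c := fun q => by simp [f, hc]
  have hfx : ∀ q x, x ∉ C → f q x = 0 := fun q x hx => by simp [f, hx]
  have hfj : ∀ q j, Sum.inl j ∈ C → q j = f q (Sum.inl j) := fun q j hj => by simp [f, hj]
  have hinl : ∀ j, Sum.inr j ∉ C := fun j hj => hdisj _ hj (hinr j)
  -- `q` vanishes if both parts do
  have hfin : ∀ q : Fin d → ℂ, (∀ i, Sum.inl i ∉ S ∪ C → q i = 0) → r q = 0 →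
      (∀ x, f q x = 0) → q = 0 := by
    intro q hq h1 h2
    funext i
    by_cases hi : Sum.inl i ∈ S
    · rw [hrj q i hi, h1]
    · by_cases hi' : Sum.inl i ∈ C
      · rw [hfj q i hi', h2]; rfl
      · exact hq i (by simp [hi, hi'])
  have hcycle : ∀ q : Fin d → ℂ, (∀ x, f q x = 0 → f q (τ.symm x) = 0) → q c = 0 →
      ∀ x, f q x = 0 := by
    intro q hq h0 x
    by_cases hx : x ∈ C
    · exact zero_of_sameCycle hq (hcyc x hx) ((hfc q).trans h0)
    · exact hfx q x hx
  have heqC : ∀ (z : ℂ) (q : Fin d → ℂ),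
      (∀ j, Sum.inl j ∈ C → ∑ i, q i * (A'' i j : ℂ) = z * q j) →
      ∀ x, ((R + 1 : ℝ) : ℂ) * f q (τ.symm x) = z * f q x := by
    intro z q hq x
    by_cases hx : x ∈ C
    · rcases x with j | j
      · rw [← hsumC q j hx, hq j hx, hfj q j hx]
      · exact absurd hx (hinl j)
    · rw [hfx q x hx, hfx q _ (fun h' => hx ((hC' x).2 h'))]
      simp
  -- the part on `S` vanishes for large eigenvalues, and then so does the entry at `c`
  have hlarge : ∀ (z : ℂ) (q : Fin d → ℂ), R < ‖z‖ →
      (∀ i j, τ (Sum.inl i) = Sum.inr j → q i = 0) →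
      (∀ j, Sum.inl j ∈ S → ∑ i, q i * (A'' i j : ℂ) = z * q j) → r q = 0 ∧ q c = 0 := by
    intro z q hz hB hA
    have h1 : r q = 0 := hex z hz p (r q) hp (hrS q) (hrB q hB) (fun j hjp hj => by
      have := hA j hj
      rw [hsumS q j hj, if_neg hjp, add_zero] at this
      rw [this, hrj q j hj])
    refine ⟨h1, ?_⟩
    have := hA p hp
    rw [hsumS q p hp, if_pos rfl, hrj q p hp, h1] at this
    simpa using this
  refine ⟨A'', ?_, ?_, ?_, R + 1, ha.le, ?_⟩
  · intro i j hij
    have h1 := h.isRealization i j hij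
    have h2 : cycleMatrix τ C (R + 1) i j = 0 := by
      rw [cycleMatrix, if_neg]
      rintro ⟨-, h'⟩
      simp [hτ i j h'] at hij
    have h3 : ¬ (i = c ∧ j = p) := by
      rintro ⟨rfl, rfl⟩
      simp [hpc] at hij
    simp [A'', h1, h2, h3]
  · intro i j hij
    have h1 : A' i j = 0 := h.support i j (by
      rcases hij with h' | h'
      · exact Or.inl fun h'' => h' (Or.inl h'')
      · exact Or.inr fun h'' => h' (Or.inl h''))
    have h2 : cycleMatrix τ C (R + 1) i j = 0 := by
      rw [cycleMatrix, if_neg]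
      rintro ⟨h', h''⟩
      rcases hij with h3 | h3
      · exact h3 (Or.inr h')
      · exact h3 (Or.inr (h'' ▸ (hC _).1 h'))
    have h3 : ¬ (i = c ∧ j = p) := by
      rintro ⟨rfl, rfl⟩
      rcases hij with h' | h'
      · exact h' (Or.inr hc)
      · exact h' (Or.inl hp)
    simp [A'', h1, h2, h3]
  · intro z q hq hB hA
    have hAC := heqC z q fun j hj => hA j (Or.inr hj)
    have hqc : q c = 0 := by
      -- Off this circle the cycle carries no eigenvector. On it the eigenvalue exceeds `R`, so the
      -- old part vanishes without the equation at `p`, which then reads `q c = 0`.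
      by_cases hz : ‖z‖ = R + 1
      · exact (hlarge z q (by linarith) hB fun j hj => hA j (Or.inl hj)).2
      · rw [← hfc q]
        exact zero_of_norm_ne ha.le hz hAC _
    have hf : ∀ x, f q x = 0 := hcycle q (fun x hx => by
      have := hAC x
      rw [hx, mul_zero] at this
      exact (mul_eq_zero.1 this).resolve_left ha') hqc
    refine hfin q hq (h.eigen z (r q) (hrS q) (hrB q hB) fun j hj => ?_) hf
    have := hA j (Or.inl hj)
    rw [hsumS q j hj, hqc, hrj q j hj] at this
    simpa using this
  · intro z hz p' q hp' hq hB hA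
    have hz0 : z ≠ 0 := norm_pos_iff.1 (by linarith)
    -- If the dropped equation belongs to `S`, the cycle is complete and `‖z‖ > R + 1` kills its
    -- part; the old part is then unperturbed. If it belongs to `C`, all equations on `S` are
    -- available and give `q c = 0`, and counting zeros on the cycle makes up for the missing one.
    rcases hp' with hp' | hp'
    · have hAC := heqC z q fun j hj => hA j (fun h' => hdisj _ hj (h' ▸ hp')) (Or.inr hj)
      have hf := zero_of_norm_ne ha.le hz.ne' hAC
      have hqc : q c = 0 := by rw [← hfc q]; exact hf _
      refine hfin q hq (hex z (by linarith) p' (r q) hp' (hrS q) (hrB q hB) fun j hj' hj => ?_) hf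
      have := hA j hj' (Or.inl hj)
      rw [hsumS q j hj, hqc, hrj q j hj] at this
      simpa using this
    · obtain ⟨h1, h2⟩ := hlarge z q (by linarith) hB
        (fun j hj => hA j (fun h' => hdisj _ hp' (h' ▸ hj)) (Or.inl hj))
      refine hfin q hq h1 (hcycle q (fun x => (zero_iff_of_except (Sum.inl p') ?_ x).1) h2)
      intro x hx
      by_cases hxC : x ∈ C
      · rcases x with j | j
        · have := hA j (fun h' => hx (h' ▸ rfl)) (Or.inr hxC)
          rw [hsumC q j hxC, hfj q j hxC] at this
          constructor
          · intro h'
            rw [h', mul_zero] at this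
            exact (mul_eq_zero.1 this).resolve_left ha'
          · intro h'
            rw [h', mul_zero] at this
            exact (mul_eq_zero.1 this.symm).resolve_left hz0
        · exact absurd hxC (hinl j)
      · rw [hfx q x hxC, hfx q _ (fun h' => hxC ((hC' x).2 h'))]

/-- Take a maximal `τ`-invariant set that contains the inputs and has a partial realization; the
cycles through inputs give a first one. By strong connectivity a missing state yields an edge
leaving the set, and the whole cycle at its head can be added. -/
theorem exists_partialRealization_univ {A : SparsityMatrix d d}
    {τ : Equiv.Perm (Fin d ⊕ Fin m)} (hA : IsStronglyConnected (stateDigraph A))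
    (hτ : ∀ i j, τ (Sum.inl i) = Sum.inl j → A i j = true)
    (hin : ∃ i j, τ (Sum.inl i) = Sum.inr j) :
    ∃ A', PartialRealization A τ Set.univ A' := by
  let good : Set (Set (Fin d ⊕ Fin m)) := {S | (∀ x, x ∈ S ↔ τ x ∈ S) ∧ (∀ j, Sum.inr j ∈ S) ∧
    ∃ A', PartialRealization A τ S A'}
  have hinv : ∀ y x, τ.SameCycle y x ↔ τ.SameCycle y (τ x) := fun y x =>
    Equiv.Perm.sameCycle_apply_right.symm
  have hne : good.Nonempty := by
    refine ⟨{x | ∃ j, τ.SameCycle (Sum.inr j) x}, ?_, ?_, _,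
      partialRealization_stems hτ ?_ (fun x hx => hx)⟩
    · exact fun x => exists_congr fun j => hinv _ x
    · exact fun j => ⟨j, Equiv.Perm.SameCycle.refl _ _⟩
    · exact fun x => exists_congr fun j => hinv _ x
  obtain ⟨S, ⟨hS, hinr, A', hA'⟩, hmax⟩ := (Set.toFinite good).exists_maximal hne
  suffices hS1 : ∀ j, Sum.inl j ∈ S by
    have : S = Set.univ := by
      ext x
      rcases x with j | j
      · simp [hS1 j]
      · simp [hinr j]
    exact ⟨A', this ▸ hA'⟩
  by_contra! hout
  obtain ⟨c', hc'⟩ := hout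
  obtain ⟨i₀, j₀, h₀⟩ := hin
  -- A matched input is needed here: otherwise the set could contain no state from which an edge
  -- leaves.
  have hi₀ : Sum.inl i₀ ∈ S := (hS _).2 (h₀ ▸ hinr j₀)
  obtain ⟨p, c, hp, hc, hpc⟩ : ∃ p c, Sum.inl p ∈ S ∧ Sum.inl c ∉ S ∧ A c p = true := by
    by_contra! hno
    apply hc'
    have hpath := hA i₀ c'
    induction hpath with
    | refl => exact hi₀
    | tail _ hbc ih =>
      by_contra hcS
      exact hno _ _ (by
        by_contra hb
        exact hb (ih hb)) hcS hbc
  have hSC : ∀ x, τ.SameCycle (Sum.inl c) x → x ∉ S := by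
    intro x hx hxS
    obtain ⟨n, hn⟩ := hx.exists_nat_pow_eq
    apply hc
    have : ∀ n : ℕ, (τ ^ n) (Sum.inl c) ∈ S → Sum.inl c ∈ S := by
      intro n
      induction n with
      | zero => simp
      | succ n ih =>
        rw [pow_succ', Equiv.Perm.mul_apply, ← hS]
        exact ih
    exact this n (hn ▸ hxS)
  obtain ⟨A'', hA''⟩ := hA'.extend hτ hinr (C := {x | τ.SameCycle (Sum.inl c) x})
    (hinv _) hSC hp (Equiv.Perm.SameCycle.refl _ _) (fun x hx => hx) hpc
  have hle := hmax (y := S ∪ {x | τ.SameCycle (Sum.inl c) x})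
    ⟨fun x => or_congr (hS x) (hinv _ x), fun j => Or.inl (hinr j), A'', hA''⟩
    Set.subset_union_left
  exact hc (hle (Or.inr (Equiv.Perm.SameCycle.refl _ _)))

/-- A strongly connected system is structurally controllable if `Γ(A,B)` has a matching that
saturates the right side and uses an input. -/
theorem structurallyControllable_of_injective {A : SparsityMatrix d d} {B : SparsityMatrix d m}
    (hA : IsStronglyConnected (stateDigraph A)) {σ : Fin d → Fin d ⊕ Fin m}
    (hσ : Function.Injective σ) (hσE : ∀ i, (σ i, i) ∈ gammaAB A B)
    (hin : ∃ i j, σ i = Sum.inr j) : StructurallyControllable A B := by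
  obtain ⟨τ, hτ⟩ := exists_perm_extending hσ
  obtain ⟨A', hA'⟩ := exists_partialRealization_univ (τ := τ) hA
    (fun i j hij => by rw [hτ] at hij; exact mem_gammaAB_inl.1 (hij ▸ hσE i))
    (by simpa only [hτ] using hin)
  -- Only matched input edges receive the value `1`. Each used input then acts on a single state, so
  -- annihilation by this matrix means that `q` vanishes at the states matched to inputs.
  refine ⟨A', Matrix.of fun i j => if σ i = Sum.inr j then 1 else 0, hA'.isRealization, ?_, ?_⟩
  · intro i j hij
    refine if_neg fun h => ?_
    have hE := hσE i
    rw [h, mem_gammaAB_inr, hij] at hE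
    cases hE
  · refine controllable_of_eigenvectors fun z q hq hB => hA'.eigen z q (by simp) ?_ ?_
    · intro i j hij
      rw [hτ] at hij
      have := congrFun hB j
      simp only [vecMul, dotProduct, Matrix.map_apply, Matrix.of_apply, Pi.zero_apply] at this
      rw [Finset.sum_eq_single i] at this
      · simpa [hij] using this
      · intro i' _ hi'
        rw [if_neg, Complex.ofReal_zero, mul_zero]
        exact fun h => hi' (hσ (h.trans hij.symm))
      · simp
    · intro j _
      have := congrFun hq j
      simpa [vecMul, dotProduct] using this

end Realization

end StructCtrl

namespace StructCtrl

/-! ### Matchings that saturate the right side -/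

theorem injective_graph {L R : Type*} (σ : R → L) : Function.Injective fun r => (σ r, r) :=
  fun _ _ h => (Prod.ext_iff.1 h).2

theorem IsMatching.injOn_snd {L R : Type*} {E M : Finset (L × R)} (h : IsMatching E M) :
    Set.InjOn Prod.snd (M : Set (L × R)) := fun e he f hf hef => h.2 e he f hf (Or.inr hef)

theorem IsMatching.card_le {L R : Type*} [Fintype R] {E M : Finset (L × R)} (h : IsMatching E M) :
    M.card ≤ Fintype.card R := by
  classical
  rw [← Finset.card_image_of_injOn h.injOn_snd]
  exact Finset.card_le_univ _

section Matching

variable {L R : Type*} [Fintype R] [DecidableEq L] [DecidableEq R]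

/-- The edges `(σ r, r)`. -/
def matchingOf (σ : R → L) : Finset (L × R) := Finset.univ.image fun r => (σ r, r)

theorem mem_matchingOf {σ : R → L} {l : L} {r : R} : (l, r) ∈ matchingOf σ ↔ σ r = l := by
  simp [matchingOf]

theorem card_matchingOf (σ : R → L) : (matchingOf σ).card = Fintype.card R :=
  Finset.card_image_of_injective _ (injective_graph σ)

theorem sum_matchingOf (σ : R → L) (c : L × R → ℝ) :
    ∑ e ∈ matchingOf σ, c e = ∑ r, c (σ r, r) :=
  Finset.sum_image fun _ _ _ _ h => injective_graph σ h

theorem isMatching_matchingOf {E : Finset (L × R)} {σ : R → L} (hσ : Function.Injective σ)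
    (hE : ∀ r, (σ r, r) ∈ E) : IsMatching E (matchingOf σ) := by
  constructor
  · rintro ⟨l, r⟩ h
    rw [← mem_matchingOf.1 h]
    exact hE r
  · rintro ⟨l, r⟩ h ⟨l', r'⟩ h' (rfl | rfl)
    · rw [hσ ((mem_matchingOf.1 h).trans (mem_matchingOf.1 h').symm)]
    · rw [← mem_matchingOf.1 h, ← mem_matchingOf.1 h']

theorem IsMatching.exists_eq_matchingOf {E M : Finset (L × R)} (h : IsMatching E M)
    (hM : M.card = Fintype.card R) :
    ∃ σ : R → L, Function.Injective σ ∧ (∀ r, (σ r, r) ∈ E) ∧ M = matchingOf σ := by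
  have hsurj : M.image Prod.snd = Finset.univ := by
    apply Finset.eq_univ_of_card
    rw [Finset.card_image_of_injOn h.injOn_snd, hM]
  have hex : ∀ r, ∃ l, (l, r) ∈ M := by
    intro r
    have hr := Finset.mem_univ r
    rw [← hsurj, Finset.mem_image] at hr
    obtain ⟨⟨l, r'⟩, hl, rfl⟩ := hr
    exact ⟨l, hl⟩
  choose σ hσ using hex
  refine ⟨σ, fun r r' hr => ?_, fun r => h.1 (hσ r), ?_⟩
  · exact (Prod.ext_iff.1 (h.2 _ (hσ r) _ (hσ r') (Or.inl hr))).2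
  · symm
    apply Finset.eq_of_subset_of_card_le
    · rintro ⟨l, r⟩ hl
      rw [← mem_matchingOf.1 hl]
      exact hσ r
    · rw [card_matchingOf, hM]

/-- A matching has at most one edge per right vertex, so once the right side can be saturated, every
maximum matching saturates it and is the graph of an injection. -/
theorem isMaximumMatching_iff {E : Finset (L × R)}
    (hex : ∃ σ : R → L, Function.Injective σ ∧ ∀ r, (σ r, r) ∈ E) (M : Finset (L × R)) :
    IsMaximumMatching E M ↔
      ∃ σ : R → L, Function.Injective σ ∧ (∀ r, (σ r, r) ∈ E) ∧ M = matchingOf σ := by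
  constructor
  · rintro ⟨h, hmax⟩
    obtain ⟨σ, hσ, hE⟩ := hex
    refine h.exists_eq_matchingOf (le_antisymm h.card_le ?_)
    have := hmax _ (isMatching_matchingOf hσ hE)
    rwa [card_matchingOf] at this
  · rintro ⟨σ, hσ, hE, rfl⟩
    refine ⟨isMatching_matchingOf hσ hE, fun M' hM' => ?_⟩
    rw [card_matchingOf]
    exact hM'.card_le

/-- If the right side can be saturated, then the minimum cost maximum matchings are given by
the cheapest injections. -/
theorem isMCMM_matchingOf {E : Finset (L × R)} {c : L × R → ℝ} {σ : R → L}
    (hσ : Function.Injective σ) (hE : ∀ r, (σ r, r) ∈ E)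
    (hmin : ∀ σ' : R → L, Function.Injective σ' → (∀ r, (σ' r, r) ∈ E) →
      ∑ r, c (σ r, r) ≤ ∑ r, c (σ' r, r)) : IsMCMM E c (matchingOf σ) := by
  refine ⟨(isMaximumMatching_iff ⟨σ, hσ, hE⟩ _).2 ⟨σ, hσ, hE, rfl⟩, fun M' hM' => ?_⟩
  obtain ⟨σ', hσ', hE', rfl⟩ := (isMaximumMatching_iff ⟨σ, hσ, hE⟩ _).1 hM'
  rw [sum_matchingOf, sum_matchingOf]
  exact hmin σ' hσ' hE'

end Matching

variable {d m : ℕ}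

theorem inputMatrixOf_matchingOf (σ : Fin d → Fin d ⊕ Fin m) (i : Fin d) (j : Fin m) :
    inputMatrixOf (matchingOf σ) i j = decide (σ i = Sum.inr j) := by
  simp [inputMatrixOf, mem_matchingOf]

theorem connectionCost_matchingOf (w : Fin d → Fin m → ℝ) (σ : Fin d → Fin d ⊕ Fin m) :
    connectionCost w (inputMatrixOf (matchingOf σ)) = ∑ i, edgeCost w (σ i, i) := by
  refine Finset.sum_congr rfl fun i _ => ?_
  simp only [inputMatrixOf_matchingOf, decide_eq_true_eq]
  rcases σ i with j | j
  · simp [edgeCost]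
  · simp [edgeCost]

/-- Each right vertex has one matching edge: a state edge is free, and an input edge is one of the
nonnegative terms of its row. The bound serves both the comparison with an arbitrary `B'` and the
choice of the cost of non-edges. -/
theorem sum_edgeCost_le_connectionCost {A : SparsityMatrix d d} {B : SparsityMatrix d m}
    {w : Fin d → Fin m → ℝ} (hw : ∀ i j, B i j = true → 0 ≤ w i j)
    {σ : Fin d → Fin d ⊕ Fin m} (hσ : ∀ i, (σ i, i) ∈ gammaAB A B) :
    ∑ i, edgeCost w (σ i, i) ≤ connectionCost w B := by
  refine Finset.sum_le_sum fun i _ => ?_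
  have hnn : ∀ j ∈ Finset.univ, 0 ≤ if B i j = true then w i j else 0 := fun j _ => by
    split_ifs with h
    · exact hw i j h
    · exact le_rfl
  have hi := hσ i
  rcases h : σ i with j | j
  · exact Finset.sum_nonneg hnn
  · refine le_trans (le_of_eq ?_) (Finset.single_le_sum hnn (Finset.mem_univ j))
    rw [h, mem_gammaAB_inr] at hi
    simp [edgeCost, hi]

/-- Without inputs the injection would map the finite set of states to itself, hence be bijective
and perfect in `Γ(A)`. -/
theorem exists_input_of_not_perfect {A : SparsityMatrix d d} {B : SparsityMatrix d m}
    (hA : ¬ ∃ M, IsPerfectMatching (gammaA A) M) {σ : Fin d → Fin d ⊕ Fin m}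
    (hσ : Function.Injective σ) (hE : ∀ i, (σ i, i) ∈ gammaAB A B) :
    ∃ i j, σ i = Sum.inr j := by
  by_contra! hno
  have hex : ∀ i, ∃ j, σ i = Sum.inl j := by
    intro i
    rcases h : σ i with j | j
    · exact ⟨j, rfl⟩
    · exact absurd h (hno i j)
  choose π hπ using hex
  have hinj : Function.Injective π := fun i i' h => hσ (by rw [hπ, hπ, h])
  apply hA
  refine ⟨matchingOf π, isMatching_matchingOf hinj fun i => ?_, fun l => ?_, fun r => ?_⟩
  · have := hE i
    rw [hπ, mem_gammaAB_inl] at this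
    simpa [gammaA] using this
  · obtain ⟨r, hr⟩ := (Finite.injective_iff_surjective.1 hinj) l
    exact ⟨(l, r), mem_matchingOf.2 hr, rfl⟩
  · exact ⟨(π r, r), mem_matchingOf.2 rfl, rfl⟩

/-- Admissibility comes from the matching itself, whose edges survive in `Γ(A,B*)`. For the lower
bound, an admissible `B'` has a saturating matching, which competes with `M` inside `Γ(A,B)` and
costs at most the weight of `B'`. -/
theorem IsMCMM.solvesMinCost {A : SparsityMatrix d d} {B : SparsityMatrix d m}
    {w : Fin d → Fin m → ℝ} (hAB : StructurallyControllable A B)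
    (hw : ∀ i j, B i j = true → 0 ≤ w i j) (hA : IsStronglyConnected (stateDigraph A))
    (hperf : ¬ ∃ M, IsPerfectMatching (gammaA A) M) {M : Finset ((Fin d ⊕ Fin m) × Fin d)}
    (hM : IsMCMM (gammaAB A B) (edgeCost w) M) : SolvesMinCost A B w (inputMatrixOf M) := by
  obtain ⟨σ, hσ, hE, rfl⟩ := (isMaximumMatching_iff hAB.exists_injective _).1 hM.1
  have hE' : ∀ i, (σ i, i) ∈ gammaAB A (inputMatrixOf (matchingOf σ)) := by
    intro i
    have hi := hE i
    rcases h : σ i with j | j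
    · rw [h, mem_gammaAB_inl] at hi
      rwa [mem_gammaAB_inl]
    · rw [mem_gammaAB_inr, inputMatrixOf_matchingOf, h]
      simp
  refine ⟨⟨fun i j hij => ?_, structurallyControllable_of_injective hA hσ hE'
    (exists_input_of_not_perfect hperf hσ hE)⟩, ?_⟩
  · rw [inputMatrixOf_matchingOf, decide_eq_false_iff_not]
    intro h
    have hi := hE i
    rw [h, mem_gammaAB_inr, hij] at hi
    cases hi
  · rintro B' ⟨hB', hAB'⟩
    have hsub : ∀ i j, B' i j = true → B i j = true := fun i j h => by
      by_contra h'
      rw [hB' i j (by simpa using h')] at h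
      cases h
    obtain ⟨σ', hσ', hσE'⟩ := hAB'.exists_injective
    have hE'' : ∀ i, (σ' i, i) ∈ gammaAB A B := by
      intro i
      have hi := hσE' i
      rcases h : σ' i with j | j
      · rw [h, mem_gammaAB_inl] at hi
        rwa [mem_gammaAB_inl]
      · rw [h, mem_gammaAB_inr] at hi
        rw [mem_gammaAB_inr]
        exact hsub i j hi
    calc connectionCost w (inputMatrixOf (matchingOf σ))
        = ∑ e ∈ matchingOf σ, edgeCost w e := by
          rw [connectionCost_matchingOf, sum_matchingOf]
      _ ≤ ∑ e ∈ matchingOf σ', edgeCost w e :=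
          hM.2 _ ((isMaximumMatching_iff hAB.exists_injective _).2 ⟨σ', hσ', hE'', rfl⟩)
      _ = ∑ i, edgeCost w (σ' i, i) := sum_matchingOf _ _
      _ ≤ connectionCost w B' :=
          sum_edgeCost_le_connectionCost (fun i j h => hw i j (hsub i j h)) hσE'

end StructCtrl

namespace StructCtrl

/-! ### The Hungarian method

Rows `r < n` are assigned to columns `j < k`; `p j` is the row assigned to the column `j`, or `n`
if there is none. During the insertion of the row `i`, the index `k` stands for a virtual column
to which the row `i` is assigned. -/

/-- The first `i` rows are assigned, and `u`, `v` are dual variables that prove optimality. -/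
structure DualPair (n k : ℕ) (c : ℕ → ℕ → ℝ) (i : ℕ) (u v : ℕ → ℝ) (p : ℕ → ℕ) : Prop where
  feas : ∀ r < n, ∀ j < k, u r + v j ≤ c r j
  range : ∀ j < k, p j < i ∨ p j = n
  inj : ∀ j < k, ∀ j' < k, p j < n → p j = p j' → j = j'
  tight : ∀ j < k, p j < n → u (p j) + v j = c (p j) j
  nonpos : ∀ j < k, v j ≤ 0
  free : ∀ j < k, p j = n → v j = 0
  cover : ∀ r < i, ∃ j < k, p j = r

/-- The search tree of alternating paths from the row `i`: `used` and `rused` mark its columns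
and rows, `way` are the predecessors, `minv` the smallest slacks, `ord` the times of entry. -/
structure SearchTree (n k : ℕ) (c : ℕ → ℕ → ℝ) (i : ℕ) (u v : ℕ → ℝ) (p way used rused : ℕ → ℕ)
    (minv : ℕ → ℝ) (ord : ℕ → ℕ) (q : ℕ) : Prop extends DualPair n k c i u v p where
  row_lt : i < n
  root : p k = i
  row_iff : ∀ r < n, rused r ≠ 0 ↔ r = i ∨ ∃ j < k, used j ≠ 0 ∧ p j = r
  used_lt : ∀ j < k, used j ≠ 0 → p j < n
  way_mem : ∀ j < k, way j = k ∨ way j < k ∧ used (way j) ≠ 0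
  minv_eq : ∀ j < k, used j = 0 → minv j = c (p (way j)) j - u (p (way j)) - v j
  minv_le : ∀ j < k, used j = 0 → ∀ r < n, rused r ≠ 0 → minv j ≤ c r j - u r - v j
  way_tight : ∀ j < k, used j ≠ 0 → u (p (way j)) + v j = c (p (way j)) j
  way_ord : ∀ j < k, used j ≠ 0 → way j = k ∨ ord (way j) < ord j
  ord_lt : ∀ j < k, used j ≠ 0 → ord j < q
  card_used : ((Finset.range k).filter fun j => used j ≠ 0).card = q

/-- The initial tree has the root row only. Storing `i` at the virtual column `k` and setting all
predecessors to `k` lets the formula `p (way j)` produce the root without a separate case. -/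
theorem DualPair.searchTree {n k : ℕ} {c : ℕ → ℕ → ℝ} {i : ℕ} {u v : ℕ → ℝ}
    {p p' way used rused : ℕ → ℕ} {minv : ℕ → ℝ} (h : DualPair n k c i u v p) (hi : i < n)
    (hp : ∀ j < k, p' j = p j) (hpk : p' k = i) (hway : ∀ j < k, way j = k)
    (hused : ∀ j < k, used j = 0) (hrused : ∀ r < n, rused r ≠ 0 ↔ r = i)
    (hminv : ∀ j < k, minv j = c i j - u i - v j) :
    SearchTree n k c i u v p' way used rused minv 0 0 where
  feas := h.feas
  range j hj := by rw [hp j hj]; exact h.range j hj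
  inj j hj j' hj' := by rw [hp j hj, hp j' hj']; exact h.inj j hj j' hj'
  tight j hj := by rw [hp j hj]; exact h.tight j hj
  nonpos := h.nonpos
  free j hj := by rw [hp j hj]; exact h.free j hj
  cover r hr := by
    obtain ⟨j, hj, hr⟩ := h.cover r hr
    exact ⟨j, hj, by rw [hp j hj, hr]⟩
  row_lt := hi
  root := hpk
  row_iff r hr := by
    rw [hrused r hr]
    refine ⟨Or.inl, ?_⟩
    rintro (h | ⟨j, hj, h, -⟩)
    · exact h
    · exact absurd (hused j hj) h
  used_lt j hj h := absurd (hused j hj) h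
  way_mem j hj := Or.inl (hway j hj)
  minv_eq j hj _ := by rw [hway j hj, hpk, hminv j hj]
  minv_le j hj _ r hr hr' := by rw [(hrused r hr).1 hr', hminv j hj]
  way_tight j hj h := absurd (hused j hj) h
  way_ord j hj h := absurd (hused j hj) h
  ord_lt j hj h := absurd (hused j hj) h
  card_used := by
    rw [Finset.card_eq_zero, Finset.filter_eq_empty_iff]
    intro j hj
    simpa using hused j (Finset.mem_range.1 hj)

/-! ### Invariants of the search tree -/

namespace SearchTree

variable {n k : ℕ} {c : ℕ → ℕ → ℝ} {i : ℕ} {u v : ℕ → ℝ} {p way used rused : ℕ → ℕ}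
    {minv : ℕ → ℝ} {ord : ℕ → ℕ} {q : ℕ}

theorem used_lt_row (h : SearchTree n k c i u v p way used rused minv ord q) {j : ℕ} (hj : j < k)
    (hu : used j ≠ 0) : p j < i := by
  have h1 := h.used_lt j hj hu
  rcases h.range j hj with h2 | h2
  · exact h2
  · omega

theorem way_row (h : SearchTree n k c i u v p way used rused minv ord q) {j : ℕ} (hj : j < k) :
    p (way j) < n ∧ rused (p (way j)) ≠ 0 := by
  rcases h.way_mem j hj with h1 | ⟨h1, h2⟩
  · rw [h1, h.root]
    exact ⟨h.row_lt, (h.row_iff i h.row_lt).2 (Or.inl rfl)⟩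
  · have h3 := h.used_lt _ h1 h2
    exact ⟨h3, (h.row_iff _ h3).2 (Or.inr ⟨_, h1, h2, rfl⟩)⟩

theorem minv_nonneg (h : SearchTree n k c i u v p way used rused minv ord q) {j : ℕ} (hj : j < k)
    (hu : used j = 0) : 0 ≤ minv j := by
  rw [h.minv_eq j hj hu]
  linarith [h.feas _ (h.way_row hj).1 j hj]

/-- The assignment injects the marked columns into the rows already inserted. This bounds the number
of growth steps and leaves an unmarked column to select. -/
theorem card_le (h : SearchTree n k c i u v p way used rused minv ord q) : q ≤ i := by
  rw [← h.card_used, ← Finset.card_range i]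
  refine Finset.card_le_card_of_injOn p (fun j hj => ?_) (fun j hj j' hj' hjj => ?_)
  · simp only [Finset.coe_filter, Finset.mem_range, Set.mem_ofPred_eq] at hj
    simpa using h.used_lt_row hj.1 hj.2
  · simp only [Finset.coe_filter, Finset.mem_range, Set.mem_ofPred_eq] at hj hj'
    exact h.inj j hj.1 j' hj'.1 (h.used_lt j hj.1 hj.2) hjj

theorem exists_unused (h : SearchTree n k c i u v p way used rused minv ord q) (hnk : n ≤ k) :
    ∃ j < k, used j = 0 := by
  by_contra! hno
  have h1 := h.card_used
  rw [Finset.filter_true_of_mem (fun j hj => hno j (Finset.mem_range.1 hj)),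
    Finset.card_range] at h1
  have := h.card_le
  have := h.row_lt
  omega

/-- A matched column and its row enter the tree together, since the root is not yet assigned to a
genuine column. Hence a dual shift keeps matched edges tight. -/
theorem rused_matched (h : SearchTree n k c i u v p way used rused minv ord q) {j : ℕ}
    (hj : j < k) (hp : p j < n) : rused (p j) ≠ 0 ↔ used j ≠ 0 := by
  rw [h.row_iff _ hp]
  constructor
  · rintro (h1 | ⟨j', hj', h1, h2⟩)
    · rcases h.range j hj with h2 | h2 <;> omega
    · rwa [h.inj j hj j' hj' hp h2.symm]
  · exact fun h1 => Or.inr ⟨j, hj, h1, rfl⟩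

/-- Changing the dual variables by at most the smallest slack. -/
theorem shift (h : SearchTree n k c i u v p way used rused minv ord q) {δ : ℝ} (hδ : 0 ≤ δ)
    (hmin : ∀ j < k, used j = 0 → δ ≤ minv j) {u' v' minv' : ℕ → ℝ}
    (hu : ∀ r < n, u' r = if rused r = 0 then u r else u r + δ)
    (hv : ∀ j < k, v' j = if used j = 0 then v j else v j - δ)
    (hm : ∀ j < k, used j = 0 → minv' j = minv j - δ) :
    SearchTree n k c i u' v' p way used rused minv' ord q :=
  { h with
    feas := by
      intro r hr j hj
      have h1 := h.feas r hr j hj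
      rw [hu r hr, hv j hj]
      split_ifs with h2 h3 h3
      · exact h1
      · linarith
      -- The critical case: the row is raised and the column is not, so the slack drops by `δ`,
      -- which is at most the smallest slack.
      · linarith [hmin j hj h3, h.minv_le j hj h3 r hr h2]
      · linarith
    tight := by
      intro j hj hp
      have h1 := h.tight j hj hp
      have h2 := h.rused_matched hj hp
      rw [hu _ hp, hv j hj]
      split_ifs with h3 h4 h4
      · exact h1
      · exact absurd h3 (h2.2 h4)
      · exact absurd h4 (h2.1 h3)
      · linarith
    nonpos := by
      intro j hj
      have h1 := h.nonpos j hj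
      rw [hv j hj]
      split_ifs
      · exact h1
      · linarith
    free := by
      intro j hj hp
      rw [hv j hj, if_pos, h.free j hj hp]
      by_contra h1
      have := h.used_lt j hj h1
      omega
    minv_eq := by
      intro j hj h1
      obtain ⟨h2, h3⟩ := h.way_row hj
      rw [hm j hj h1, hu _ h2, hv j hj, if_pos h1, if_neg h3, h.minv_eq j hj h1]
      ring
    minv_le := by
      intro j hj h1 r hr hr'
      have := h.minv_le j hj h1 r hr hr'
      rw [hm j hj h1, hu r hr, hv j hj, if_pos h1, if_neg hr']
      linarith
    way_tight := by
      intro j hj h1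
      obtain ⟨h2, h3⟩ := h.way_row hj
      rw [hu _ h2, hv j hj, if_neg h1, if_neg h3]
      linarith [h.way_tight j hj h1] }

/-- Adding a matched column that is joined to the tree by a tight edge. -/
theorem grow (h : SearchTree n k c i u v p way used rused minv ord q) {j₁ : ℕ} (hj₁ : j₁ < k)
    (hu₁ : used j₁ = 0) (hm₁ : minv j₁ = 0) (hp₁ : p j₁ < n) {way' : ℕ → ℕ} {minv' : ℕ → ℝ}
    (hw : ∀ j < k, way' j = if Function.update used j₁ 1 j = 0 ∧
      c (p j₁) j - u (p j₁) - v j < minv j then j₁ else way j)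
    (hm : ∀ j < k, minv' j = if Function.update used j₁ 1 j = 0 ∧
      c (p j₁) j - u (p j₁) - v j < minv j then c (p j₁) j - u (p j₁) - v j else minv j) :
    SearchTree n k c i u v p way' (Function.update used j₁ 1)
      (Function.update rused (p j₁) 1) minv' (Function.update ord j₁ q) (q + 1) := by
  have hU : ∀ j, Function.update used j₁ 1 j ≠ 0 ↔ used j ≠ 0 ∨ j = j₁ := by
    intro j
    by_cases hj : j = j₁
    · simp [hj]
    · simp [hj]
  have hR : ∀ r, Function.update rused (p j₁) 1 r ≠ 0 ↔ rused r ≠ 0 ∨ r = p j₁ := by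
    intro r
    by_cases hr : r = p j₁
    · simp [hr]
    · simp [hr]
  have hwj : ∀ j < k, Function.update used j₁ 1 j ≠ 0 → way' j = way j := fun j hj h1 => by
    rw [hw j hj, if_neg (fun h2 => h1 h2.1)]
  have hw₁ : way j₁ ≠ j₁ := by
    rcases h.way_mem j₁ hj₁ with h1 | ⟨h1, h2⟩
    · omega
    · intro h3
      rw [h3] at h2
      exact h2 hu₁
  refine ⟨h.toDualPair, h.row_lt, h.root, ?_, ?_, ?_, ?_, ?_, ?_, ?_, ?_, ?_⟩
  · intro r hr
    rw [hR, h.row_iff r hr]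
    constructor
    · rintro ((h1 | ⟨j, hj, h1, h2⟩) | h1)
      · exact Or.inl h1
      · exact Or.inr ⟨j, hj, (hU j).2 (Or.inl h1), h2⟩
      · exact Or.inr ⟨j₁, hj₁, (hU j₁).2 (Or.inr rfl), h1.symm⟩
    · rintro (h1 | ⟨j, hj, h1, h2⟩)
      · exact Or.inl (Or.inl h1)
      · rcases (hU j).1 h1 with h3 | rfl
        · exact Or.inl (Or.inr ⟨j, hj, h3, h2⟩)
        · exact Or.inr h2.symm
  · intro j hj h1
    rcases (hU j).1 h1 with h3 | rfl
    · exact h.used_lt j hj h3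
    · exact hp₁
  · intro j hj
    rw [hw j hj]
    split_ifs
    · exact Or.inr ⟨hj₁, (hU j₁).2 (Or.inr rfl)⟩
    · rcases h.way_mem j hj with h2 | ⟨h2, h3⟩
      · exact Or.inl h2
      · exact Or.inr ⟨h2, (hU _).2 (Or.inl h3)⟩
  · intro j hj h1
    have h2 : used j = 0 := by
      by_contra h3
      exact (hU j).2 (Or.inl h3) h1
    rw [hw j hj, hm j hj]
    split_ifs
    · rfl
    · exact h.minv_eq j hj h2
  · intro j hj h1 r hr h2
    have h3 : used j = 0 := by
      by_contra h3
      exact (hU j).2 (Or.inl h3) h1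
    have h4 : minv' j ≤ minv j ∧ minv' j ≤ c (p j₁) j - u (p j₁) - v j := by
      rw [hm j hj]
      split_ifs with h5
      · exact ⟨h5.2.le, le_rfl⟩
      · exact ⟨le_rfl, not_lt.1 fun h6 => h5 ⟨h1, h6⟩⟩
    rcases (hR r).1 h2 with h5 | rfl
    · exact h4.1.trans (h.minv_le j hj h3 r hr h5)
    · exact h4.2
  · intro j hj h1
    rw [hwj j hj h1]
    rcases (hU j).1 h1 with h2 | rfl
    · exact h.way_tight j hj h2
    · have := h.minv_eq j hj hu₁
      linarith
  · intro j hj h1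
    rw [hwj j hj h1]
    rcases (hU j).1 h1 with h2 | rfl
    · have hne : j ≠ j₁ := fun h3 => h2 (h3 ▸ hu₁)
      rcases h.way_ord j hj h2 with h3 | h3
      · exact Or.inl h3
      · rcases h.way_mem j hj with h4 | ⟨h4, h5⟩
        · exact Or.inl h4
        · have hne' : way j ≠ j₁ := fun h6 => h5 (h6 ▸ hu₁)
          right
          simpa [hne, hne'] using h3
    · rcases h.way_mem j hj with h4 | ⟨h4, h5⟩
      · exact Or.inl h4
      · right
        simpa [hw₁] using h.ord_lt _ h4 h5
  · intro j hj h1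
    by_cases hjj : j = j₁
    · simp [hjj]
    · have h2 : used j ≠ 0 := ((hU j).1 h1).resolve_right hjj
      have := h.ord_lt j hj h2
      simp only [Function.update_of_ne hjj]
      omega
  · have : ((Finset.range k).filter fun j => Function.update used j₁ 1 j ≠ 0) =
        insert j₁ ((Finset.range k).filter fun j => used j ≠ 0) := by
      ext j
      rw [Finset.mem_insert, Finset.mem_filter, Finset.mem_filter, hU, Finset.mem_range]
      constructor
      · tauto
      · rintro (rfl | h1)
        · exact ⟨hj₁, Or.inr rfl⟩
        · exact ⟨h1.1, Or.inl h1.2⟩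
    rw [this, Finset.card_insert_of_notMem (by simp [hu₁]), h.card_used]

end SearchTree

/-- The state during the augmentation along the path that `way` describes: the column `h` is to
receive a new row, and the columns in `W` that entered the tree before the time `b` have not been
touched. -/
structure Augmenting (n k : ℕ) (c : ℕ → ℕ → ℝ) (i : ℕ) (u v : ℕ → ℝ) (p way : ℕ → ℕ)
    (W : ℕ → Prop) (ord : ℕ → ℕ) (h b : ℕ) : Prop where
  feas : ∀ r < n, ∀ j < k, u r + v j ≤ c r j
  nonpos : ∀ j < k, v j ≤ 0
  hole_le : h ≤ k
  range : ∀ j ≤ k, j ≠ h → p j < i + 1 ∨ p j = n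
  inj : ∀ j ≤ k, ∀ j' ≤ k, j ≠ h → j' ≠ h → p j < n → p j = p j' → j = j'
  tight : ∀ j < k, j ≠ h → p j < n → u (p j) + v j = c (p j) j
  free : ∀ j < k, j ≠ h → p j = n → v j = 0
  cover : ∀ r < i + 1, ∃ j ≤ k, j ≠ h ∧ p j = r
  hole : h < k → W h ∧ ord h < b
  path : ∀ j < k, W j → ord j < b → u (p (way j)) + v j = c (p (way j)) j ∧ p (way j) < n ∧
    (way j = k ∨ way j < k ∧ W (way j) ∧ ord (way j) < ord j)

/-- Counting the virtual column, the rows up to `i` already have columns, and the free column `j₁`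
is the hole. It receives the entry time `q`, later than every tree column, so following predecessors
strictly decreases the time. -/
theorem SearchTree.augmenting {n k : ℕ} {c : ℕ → ℕ → ℝ} {i : ℕ} {u v : ℕ → ℝ}
    {p way used rused : ℕ → ℕ} {minv : ℕ → ℝ} {ord : ℕ → ℕ} {q : ℕ}
    (h : SearchTree n k c i u v p way used rused minv ord q) {j₁ : ℕ} (hj₁ : j₁ < k)
    (hu₁ : used j₁ = 0) (hm₁ : minv j₁ = 0) (hp₁ : p j₁ = n) :
    Augmenting n k c i u v p way (fun j => used j ≠ 0 ∨ j = j₁) (Function.update ord j₁ q) j₁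
      (q + 1) where
  feas := h.feas
  nonpos := h.nonpos
  hole_le := hj₁.le
  range j hj _ := by
    rcases hj.lt_or_eq with h1 | rfl
    · rcases h.range j h1 with h2 | h2
      · exact Or.inl (by omega)
      · exact Or.inr h2
    · exact Or.inl (by rw [h.root]; omega)
  inj := by
    have hne : ∀ j < k, p j ≠ i := fun j hj h1 => by
      have := h.row_lt
      rcases h.range j hj with h2 | h2 <;> omega
    intro j hj j' hj' _ _ hp hpp
    rcases hj.lt_or_eq with h1 | rfl
    · rcases hj'.lt_or_eq with h2 | rfl
      · exact h.inj j h1 j' h2 hp hpp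
      · exact absurd (hpp.trans h.root) (hne j h1)
    · rcases hj'.lt_or_eq with h2 | rfl
      · exact absurd (hpp.symm.trans h.root) (hne j' h2)
      · rfl
  tight j hj _ := h.tight j hj
  free j hj _ := h.free j hj
  cover r hr := by
    rcases (Nat.lt_succ_iff.1 hr).lt_or_eq with h1 | rfl
    · obtain ⟨j, hj, h2⟩ := h.cover r h1
      refine ⟨j, hj.le, fun h3 => ?_, h2⟩
      have := h.row_lt
      rw [h3] at h2
      omega
    · exact ⟨k, le_rfl, hj₁.ne', h.root⟩
  hole _ := ⟨Or.inr rfl, by simp⟩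
  path := by
    intro j hj h1 _
    refine ⟨?_, (h.way_row hj).1, ?_⟩
    · rcases h1 with h1 | rfl
      · exact h.way_tight j hj h1
      · have := h.minv_eq j hj hu₁
        linarith
    · rcases h.way_mem j hj with h2 | ⟨h2, h3⟩
      · exact Or.inl h2
      · right
        refine ⟨h2, Or.inl h3, ?_⟩
        have hne : way j ≠ j₁ := fun h6 => h3 (h6 ▸ hu₁)
        rw [Function.update_of_ne hne]
        by_cases hjj : j = j₁
        · rw [hjj, Function.update_self]
          have := h.ord_lt _ h2 h3
          rwa [hjj] at this
        · rw [Function.update_of_ne hjj]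
          rcases h.way_ord j hj (h1.resolve_right hjj) with h4 | h4
          · omega
          · exact h4

/-- The hole takes over the row of its predecessor along a tight edge, and the predecessor becomes
the new hole. Entry times decrease, so the path ahead is still unchanged. -/
theorem Augmenting.step {n k : ℕ} {c : ℕ → ℕ → ℝ} {i : ℕ} {u v : ℕ → ℝ} {p way : ℕ → ℕ}
    {W : ℕ → Prop} {ord : ℕ → ℕ} {h b : ℕ} (H : Augmenting n k c i u v p way W ord h b)
    (hh : h < k) :
    Augmenting n k c i u v (Function.update p h (p (way h))) way W ord (way h) (ord h) ∧
      ord h < b := by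
  obtain ⟨hW, hb⟩ := H.hole hh
  obtain ⟨h1, h2, h3⟩ := H.path h hh hW hb
  have hwh : way h ≠ h := by
    rcases h3 with h3 | ⟨-, -, h3⟩
    · omega
    · intro h4
      rw [h4] at h3
      omega
  have hwk : way h ≤ k := by
    rcases h3 with h3 | h3
    · exact h3.le
    · exact h3.1.le
  have hup : ∀ j, j ≠ h → Function.update p h (p (way h)) j = p j := fun j hj =>
    Function.update_of_ne hj _ _
  have hus : Function.update p h (p (way h)) h = p (way h) := Function.update_self _ _ _
  refine ⟨⟨H.feas, H.nonpos, hwk, ?_, ?_, ?_, ?_, ?_, ?_, ?_⟩, hb⟩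
  · intro j hj hj'
    by_cases hjh : j = h
    · rw [hjh, hus]
      exact H.range _ hwk hwh
    · rw [hup j hjh]
      exact H.range j hj hjh
  · intro j hj j' hj' hjw hjw' hp hpp
    by_cases hjh : j = h
    · by_cases hjh' : j' = h
      · rw [hjh, hjh']
      · rw [hjh, hus] at hp hpp
        rw [hup j' hjh'] at hpp
        exact absurd (H.inj _ hwk j' hj' hwh hjh' hp hpp).symm hjw'
    · by_cases hjh' : j' = h
      · rw [hup j hjh] at hp hpp
        rw [hjh', hus] at hpp
        exact absurd (H.inj j hj _ hwk hjh hwh hp hpp) hjw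
      · rw [hup j hjh] at hp hpp
        rw [hup j' hjh'] at hpp
        exact H.inj j hj j' hj' hjh hjh' hp hpp
  · intro j hj hjw hp
    by_cases hjh : j = h
    · rw [hjh, hus]
      exact h1
    · rw [hup j hjh] at hp ⊢
      exact H.tight j hj hjh hp
  · intro j hj hjw hp
    by_cases hjh : j = h
    · rw [hjh, hus] at hp
      omega
    · rw [hup j hjh] at hp
      exact H.free j hj hjh hp
  · intro r hr
    obtain ⟨j, hj, hjh, hjr⟩ := H.cover r hr
    by_cases hjw : j = way h
    · exact ⟨h, hh.le, hwh.symm, by rw [hus, ← hjw, hjr]⟩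
    · exact ⟨j, hj, hjw, by rw [hup j hjh, hjr]⟩
  · intro hlt
    rcases h3 with h3 | ⟨-, h3, h4⟩
    · omega
    · exact ⟨h3, h4⟩
  · intro j hj hWj hoj
    obtain ⟨h4, h5, h6⟩ := H.path j hj hWj (hoj.trans hb)
    -- `way j` is virtual or entered before `j`, which itself entered before `h`; overwriting `p h`
    -- therefore does not affect this row.
    have hne : way j ≠ h := by
      rcases h6 with h6 | ⟨-, -, h6⟩
      · omega
      · intro h7
        rw [h7] at h6
        omega
    rw [hup _ hne]
    exact ⟨h4, h5, h6⟩

theorem Augmenting.dualPair {n k : ℕ} {c : ℕ → ℕ → ℝ} {i : ℕ} {u v : ℕ → ℝ} {p way : ℕ → ℕ}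
    {W : ℕ → Prop} {ord : ℕ → ℕ} {h b : ℕ} (H : Augmenting n k c i u v p way W ord h b)
    (hh : ¬ h < k) : DualPair n k c (i + 1) u v p := by
  have hk : h = k := le_antisymm H.hole_le (not_lt.1 hh)
  subst hk
  exact
    { feas := H.feas
      range := fun j hj => H.range j hj.le hj.ne
      inj := fun j hj j' hj' => H.inj j hj.le j' hj'.le hj.ne hj'.ne
      tight := fun j hj => H.tight j hj hj.ne
      nonpos := H.nonpos
      free := fun j hj => H.free j hj hj.ne
      cover := fun r hr => by
        obtain ⟨j, hj, hjh, hjr⟩ := H.cover r hr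
        exact ⟨j, lt_of_le_of_ne hj hjh, hjr⟩ }

/-- A complete assignment with dual variables is optimal. -/
theorem DualPair.optimal {n k : ℕ} {c : ℕ → ℕ → ℝ} {u v : ℕ → ℝ} {p : ℕ → ℕ}
    (h : DualPair n k c n u v p) {f g : Fin n → ℕ} (hf : ∀ r, f r < k) (hfp : ∀ r, p (f r) = r)
    (hg : ∀ r, g r < k) (hginj : Function.Injective g) :
    ∑ r : Fin n, c r (f r) ≤ ∑ r : Fin n, c r (g r) := by
  have hfinj : Function.Injective f := fun r r' hr => Fin.ext (by rw [← hfp r, ← hfp r', hr])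
  -- Complementary slackness: columns not used by `f` are free and have `v = 0`.
  have hvf : ∑ r, v (f r) = ∑ j ∈ Finset.range k, v j := by
    rw [← Finset.sum_image (f := v) (g := f) (fun r _ r' _ hr => hfinj hr)]
    refine Finset.sum_subset ?_ ?_
    · intro j hj
      obtain ⟨r, -, rfl⟩ := Finset.mem_image.1 hj
      exact Finset.mem_range.2 (hf r)
    · intro j hj hj'
      have hjk := Finset.mem_range.1 hj
      apply h.free j hjk
      rcases h.range j hjk with h1 | h1
      · exact absurd (Finset.mem_image.2 ⟨⟨p j, h1⟩, Finset.mem_univ _,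
          h.inj _ (hf _) j hjk (by rw [hfp]; exact h1) (hfp _)⟩) hj'
      · exact h1
  -- Columns omitted by `g` contribute at most zero; here the sign condition on `v` compensates for
  -- having more columns than rows.
  have hvg : ∑ j ∈ Finset.range k, v j ≤ ∑ r, v (g r) := by
    rw [← Finset.sum_image (f := v) (g := g) (fun r _ r' _ hr => hginj hr)]
    have hsub : Finset.univ.image g ⊆ Finset.range k := by
      intro j hj
      obtain ⟨r, -, rfl⟩ := Finset.mem_image.1 hj
      exact Finset.mem_range.2 (hg r)
    rw [← Finset.sum_sdiff hsub]
    have : ∑ j ∈ Finset.range k \ Finset.univ.image g, v j ≤ 0 :=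
      Finset.sum_nonpos fun j hj =>
        h.nonpos j (Finset.mem_range.1 (Finset.mem_sdiff.1 hj).1)
    linarith
  calc ∑ r : Fin n, c r (f r) = ∑ r : Fin n, (u r + v (f r)) := by
        refine Finset.sum_congr rfl fun r _ => ?_
        have := h.tight (f r) (hf r) (by rw [hfp]; exact r.2)
        rw [hfp] at this
        exact this.symm
    _ ≤ ∑ r : Fin n, (u r + v (g r)) := by
        rw [Finset.sum_add_distrib, Finset.sum_add_distrib, hvf]
        linarith
    _ ≤ ∑ r : Fin n, c r (g r) := Finset.sum_le_sum fun r _ => h.feas r r.2 _ (hg r)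

end StructCtrl

namespace StructCtrl

/-! ### Reasoning about programs -/

/-- The registers and arrays of the machine. -/
inductive Cell where
  | nr (r : ℕ)
  | rr (x : ℕ)
  | na (a : ℕ)
  | ra (a : ℕ)
  deriving DecidableEq

/-- The register or array that an instruction writes to. -/
def Instr.target : Instr → Cell
  | .nconst r _ => .nr r
  | .ncopy r _ => .nr r
  | .ninc r => .nr r
  | .ndec r => .nr r
  | .nload r _ _ _ => .nr r
  | .nstore a _ _ _ => .na a
  | .rconst x _ => .rr x
  | .rcopy x _ => .rr x
  | .radd x _ _ => .rr x
  | .rsub x _ _ => .rr x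
  | .rload x _ _ _ => .rr x
  | .rstore a _ _ _ => .ra a

/-- The registers and arrays that a program writes to. -/
def Prog.targets : Prog → List Cell
  | .instr c => [c.target]
  | .seq p q => p.targets ++ q.targets
  | .ite _ p q => p.targets ++ q.targets
  | .loop _ p => p.targets

/-- `s` and `s'` agree outside the cells in `ts`. -/
structure Frame (ts : List Cell) (s s' : Mem) : Prop where
  nreg : ∀ r, Cell.nr r ∉ ts → s'.nreg r = s.nreg r
  rreg : ∀ x, Cell.rr x ∉ ts → s'.rreg x = s.rreg x
  narr : ∀ a, Cell.na a ∉ ts → s'.narr a = s.narr a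
  rarr : ∀ a, Cell.ra a ∉ ts → s'.rarr a = s.rarr a

theorem Frame.refl (ts : List Cell) (s : Mem) : Frame ts s s :=
  ⟨fun _ _ => rfl, fun _ _ => rfl, fun _ _ => rfl, fun _ _ => rfl⟩

theorem Frame.trans {ts : List Cell} {s s' s'' : Mem} (h : Frame ts s s') (h' : Frame ts s' s'') :
    Frame ts s s'' :=
  ⟨fun r hr => (h'.nreg r hr).trans (h.nreg r hr), fun r hr => (h'.rreg r hr).trans (h.rreg r hr),
    fun r hr => (h'.narr r hr).trans (h.narr r hr), fun r hr => (h'.rarr r hr).trans (h.rarr r hr)⟩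

theorem Frame.mono {ts ts' : List Cell} {s s' : Mem} (h : Frame ts s s') (hts : ts ⊆ ts') :
    Frame ts' s s' :=
  ⟨fun r hr => h.nreg r fun h' => hr (hts h'), fun r hr => h.rreg r fun h' => hr (hts h'),
    fun r hr => h.narr r fun h' => hr (hts h'), fun r hr => h.rarr r fun h' => hr (hts h')⟩

theorem Instr.frame (c : Instr) (s : Mem) : Frame [c.target] s (c.apply s) := by
  cases c <;> constructor <;> intro x hx <;> simp_all [Instr.target, Instr.apply]
  all_goals
    funext i j
    simp [setCell, hx]

/-- The written cells are a computable list, so for concrete programs the preservation of any other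
cell is settled by `decide`. -/
theorem Exec.frame {p : Prog} {s s' : Mem} {t : ℕ} (h : Exec p s t s') :
    Frame p.targets s s' := by
  induction h with
  | instr c s => exact c.frame s
  | seq _ _ ih₁ ih₂ =>
    exact (ih₁.mono (List.subset_append_left _ _)).trans (ih₂.mono (List.subset_append_right _ _))
  | iteTrue _ _ ih => exact ih.mono (List.subset_append_left _ _)
  | iteFalse _ _ ih => exact ih.mono (List.subset_append_right _ _)
  | loopTrue _ _ _ ih₁ ih₂ => exact ih₁.trans ih₂
  | loopFalse _ => exact Frame.refl _ _

/-- Started in `s`, the program halts after at most `T` steps in a memory that satisfies `Q`. -/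
def Runs (p : Prog) (s : Mem) (T : ℕ) (Q : Mem → Prop) : Prop :=
  ∃ t s', Exec p s t s' ∧ t ≤ T ∧ Q s'

theorem Runs.mono {p : Prog} {s : Mem} {T T' : ℕ} {Q Q' : Mem → Prop} (h : Runs p s T Q)
    (hT : T ≤ T') (hQ : ∀ s', Frame p.targets s s' → Q s' → Q' s') : Runs p s T' Q' := by
  obtain ⟨t, s', he, ht, hq⟩ := h
  exact ⟨t, s', he, ht.trans hT, hQ s' he.frame hq⟩

/-- The free parameter `T` absorbs unused time, so that branches of different length share one
bound. -/
theorem Runs.instr {c : Instr} {s : Mem} {T : ℕ} {Q : Mem → Prop} (h : Q (c.apply s)) :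
    Runs (.instr c) s (T + 1) Q :=
  ⟨1, _, .instr c s, by omega, h⟩

theorem Runs.seq {p q : Prog} {s : Mem} {T₁ T₂ : ℕ} {R Q : Mem → Prop} (h : Runs p s T₁ R)
    (h' : ∀ s', Frame p.targets s s' → R s' → Runs q s' T₂ Q) :
    Runs (.seq p q) s (T₁ + T₂) Q := by
  obtain ⟨t, s', he, ht, hr⟩ := h
  obtain ⟨t', s'', he', ht', hq⟩ := h' s' he.frame hr
  exact ⟨t + t', s'', .seq he he', by omega, hq⟩

theorem Runs.cons {c : Instr} {q : Prog} {s : Mem} {T : ℕ} {Q : Mem → Prop}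
    (h : Runs q (c.apply s) T Q) : Runs (.seq (.instr c) q) s (T + 1) Q := by
  obtain ⟨t, s', he, ht, hq⟩ := h
  exact ⟨1 + t, s', .seq (.instr c s) he, by omega, hq⟩

theorem Runs.ite {b : Test} {p q : Prog} {s : Mem} {T : ℕ} {Q : Mem → Prop}
    (hp : b.Holds s → Runs p s T Q) (hq : ¬ b.Holds s → Runs q s T Q) :
    Runs (.ite b p q) s (T + 1) Q := by
  by_cases hb : b.Holds s
  · obtain ⟨t, s', he, ht, hQ⟩ := hp hb
    exact ⟨t + 1, s', .iteTrue hb he, by omega, hQ⟩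
  · obtain ⟨t, s', he, ht, hQ⟩ := hq hb
    exact ⟨t + 1, s', .iteFalse hb he, by omega, hQ⟩

/-- Loops whose invariant contains a decreasing measure `n`. -/
theorem Runs.loop {b : Test} {p : Prog} {T : ℕ} {Q : Mem → Prop} (I : ℕ → Mem → Prop) {s : Mem}
    {n : ℕ} (h₀ : I n s)
    (hstep : ∀ n s', Frame p.targets s s' → I n s' → b.Holds s' →
      Runs p s' T fun s'' => ∃ n' < n, I n' s'')
    (hQ : ∀ n s', Frame p.targets s s' → I n s' → ¬ b.Holds s' → Q s') :
    Runs (.loop b p) s (n * (T + 1) + 1) Q := by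
  suffices h : ∀ n s', Frame p.targets s s' → I n s' →
      Runs (.loop b p) s' (n * (T + 1) + 1) Q from h n s (Frame.refl _ _) h₀
  intro n
  induction n using Nat.strong_induction_on with
  | _ n ih =>
    intro s' hs' hI
    by_cases hb : b.Holds s'
    · obtain ⟨t, s₁, he, ht, n', hn', hI'⟩ := hstep n s' hs' hI hb
      obtain ⟨t', s₂, he', ht', hq⟩ := ih n' hn' s₁ (hs'.trans he.frame) hI'
      refine ⟨t + t' + 1, s₂, .loopTrue hb he he', ?_, hq⟩
      have : (n' + 1) * (T + 1) ≤ n * (T + 1) := Nat.mul_le_mul_right _ hn'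
      rw [Nat.add_mul] at this
      omega
    · exact ⟨1, s', .loopFalse hb, by omega, hQ n s' hs' hI hb⟩

/-- The register `r` runs from `0` to the contents of the register `l`. -/
def forLoop (r l : ℕ) (p : Prog) : Prog :=
  .seq (.instr (.nconst r 0)) (.loop (.nlt r l) (.seq p (.instr (.ninc r))))

/-- Overwriting a register of natural numbers. -/
def Mem.setN (s : Mem) (r v : ℕ) : Mem := { s with nreg := Function.update s.nreg r v }

/-- An iteration costs the body plus one increment and one test; initialisation and the final test
add `2`. The invariant is required after the counter has been advanced, hence `setN` in the step. -/
theorem Runs.forLoop {r l : ℕ} {p : Prog} {s : Mem} {T K : ℕ} {Q : Mem → Prop} (I : ℕ → Mem → Prop)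
    (hr : Cell.nr r ∉ p.targets) (hl : Cell.nr l ∉ p.targets ∧ l ≠ r) (hK : s.nreg l = K)
    (h₀ : I 0 (s.setN r 0))
    (hstep : ∀ j s', j < K → s'.nreg r = j → Frame (Cell.nr r :: p.targets) s s' → I j s' →
      Runs p s' T fun s'' => I (j + 1) (s''.setN r (j + 1)))
    (hQ : ∀ s', Frame (Cell.nr r :: p.targets) s s' → I K s' → Q s') :
    Runs (forLoop r l p) s (K * (T + 2) + 2) Q := by
  have hfr : Frame (Cell.nr r :: p.targets) s (s.setN r 0) :=
    (Instr.frame (.nconst r 0) s).mono (by simp [Instr.target])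
  have hsub : (Prog.seq p (.instr (.ninc r))).targets ⊆ Cell.nr r :: p.targets := by
    intro c
    simp [Prog.targets, Instr.target]
    tauto
  have hlts : Cell.nr l ∉ Cell.nr r :: p.targets := by simp [hl.1, hl.2]
  have key : Runs (.loop (.nlt r l) (.seq p (.instr (.ninc r)))) (s.setN r 0)
      (K * (T + 2) + 1) Q := by
    refine Runs.loop (fun n s' => ∃ j, j + n = K ∧ s'.nreg r = j ∧ I j s')
      ⟨0, by omega, by simp [Mem.setN], h₀⟩ ?_ ?_
    · rintro n s' hs' ⟨j, hj, hrj, hI⟩ hb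
      have hs₁ := hfr.trans (hs'.mono hsub)
      have hjK : j < K := by
        have := hs₁.nreg l hlts
        simp only [Test.Holds] at hb
        omega
      refine Runs.seq (hstep j s' hjK hrj hs₁ hI) fun s'' hs'' hI' => ?_
      refine Runs.instr (T := 0) ⟨n - 1, by omega, j + 1, by omega, ?_, ?_⟩
      · simp [Instr.apply, hs''.nreg r hr, hrj]
      · have : (Instr.ninc r).apply s'' = s''.setN r (j + 1) := by
          simp [Instr.apply, Mem.setN, hs''.nreg r hr, hrj]
        rw [this]
        exact hI'
    · rintro n s' hs' ⟨j, hj, hrj, hI⟩ hb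
      have hs₁ := hfr.trans (hs'.mono hsub)
      have hjK : j = K := by
        have := hs₁.nreg l hlts
        simp only [Test.Holds] at hb
        omega
      exact hQ s' hs₁ (hjK ▸ hI)
  exact (Runs.cons (c := .nconst r 0) key).mono le_rfl fun _ _ h => h

/-- The function that agrees with `F` below `j` and with `G` from `j` on. -/
def upto {α : Type*} (j : ℕ) (F G : ℕ → α) : ℕ → α := fun x => if x < j then F x else G x

theorem upto_zero {α : Type*} (F G : ℕ → α) : upto 0 F G = G := by
  funext x
  simp [upto]

theorem upto_of_lt {α : Type*} {j x : ℕ} (F G : ℕ → α) (h : x < j) : upto j F G x = F x :=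
  if_pos h

theorem upto_self {α : Type*} (j : ℕ) (F G : ℕ → α) : upto j F G j = G j := by simp [upto]

theorem update_upto {α : Type*} {j : ℕ} {F G : ℕ → α} {y : α} (hy : y = F j) :
    Function.update (upto j F G) j y = upto (j + 1) F G := by
  funext x
  rcases lt_trichotomy x j with h | rfl | h
  · simp [upto, h, h.ne, Nat.lt_succ_of_lt h]
  · simp [upto, hy]
  · simp [upto, h.ne', show ¬ x < j by omega, show ¬ x < j + 1 by omega]

theorem upto_succ {α : Type*} {j : ℕ} {F G : ℕ → α} (h : F j = G j) :
    upto (j + 1) F G = upto j F G := by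
  funext x
  rcases lt_trichotomy x j with h' | rfl | h'
  · simp [upto, h', Nat.lt_succ_of_lt h']
  · simp [upto, h]
  · simp [upto, show ¬ x < j by omega, show ¬ x < j + 1 by omega]

theorem setCell_row {α : Type*} (f : ℕ → ℕ → ℕ → α) (a i j : ℕ) (v : α) :
    setCell f a i j v a i = Function.update (f a i) j v := by
  funext x
  simp [setCell, Function.update_apply]

theorem setCell_of_ne {α : Type*} (f : ℕ → ℕ → ℕ → α) {a a' : ℕ} (i j : ℕ) (v : α)
    (h : a' ≠ a) : setCell f a i j v a' = f a' := by
  funext x y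
  simp [setCell, h]

end StructCtrl

namespace StructCtrl

/-! ### The program

The registers `0`, ..., `8` of natural numbers hold the number `n` of rows, the number of inputs,
the constant `0`, the number `k` of columns, the row that is being inserted, the selected column,
the row assigned to it, a flag that ends the search, and the constant `1`. The real registers `0`
and `1` hold the cost of non-edges and the smallest slack. The arrays `3`, ..., `6` of natural
numbers hold the assignment, the predecessors, and the marks of the columns and rows; the real
arrays `1`, ..., `4` hold the cost table, the dual variables of the rows and columns, and the
slacks. -/

infixr:60 ";;" => Prog.seq

/-- An instruction without effect on the registers and arrays in use. -/
def noop : Prog := .instr (.nconst 15 0)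

/-- Finds an unmarked column with the smallest slack. -/
def selectColumn : Prog :=
  .instr (.ncopy 5 3) ;;
  forLoop 9 3 (
    .instr (.nload 10 5 2 9) ;;
    .ite (.neq 10 2)
      (.instr (.rload 2 4 2 9) ;;
        .ite (.nlt 5 3)
          (.ite (.rlt 2 1) (.instr (.ncopy 5 9) ;; .instr (.rcopy 1 2)) noop)
          (.instr (.ncopy 5 9) ;; .instr (.rcopy 1 2)))
      noop)

/-- Adds the smallest slack to the dual variables of the marked rows. -/
def shiftRows : Prog :=
  forLoop 9 0 (
    .instr (.nload 10 6 2 9) ;;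
    .ite (.neq 10 2) noop
      (.instr (.rload 2 2 2 9) ;; .instr (.radd 2 2 1) ;; .instr (.rstore 2 2 9 2)))

/-- Subtracts the smallest slack from the dual variables of the marked columns and from the slacks
of the other columns. -/
def shiftColumns : Prog :=
  forLoop 9 3 (
    .instr (.nload 10 5 2 9) ;;
    .ite (.neq 10 2)
      (.instr (.rload 2 4 2 9) ;; .instr (.rsub 2 2 1) ;; .instr (.rstore 4 2 9 2))
      (.instr (.rload 2 3 2 9) ;; .instr (.rsub 2 2 1) ;; .instr (.rstore 3 2 9 2)))

/-- Updates the slacks and predecessors of the unmarked columns by means of the row in register `6`. -/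
def relaxColumns : Prog :=
  forLoop 9 3 (
    .instr (.nload 10 5 2 9) ;;
    .ite (.neq 10 2)
      (.instr (.rload 2 1 6 9) ;; .instr (.rload 3 2 2 6) ;; .instr (.rsub 2 2 3) ;;
        .instr (.rload 3 3 2 9) ;; .instr (.rsub 2 2 3) ;; .instr (.rload 3 4 2 9) ;;
        .ite (.rlt 2 3) (.instr (.rstore 4 2 9 2) ;; .instr (.nstore 4 2 9 5)) noop)
      noop)

/-- The registers and arrays that are constant during the algorithm. -/
structure Env (n k : ℕ) (c : ℕ → ℕ → ℝ) (s : Mem) : Prop where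
  n0 : s.nreg 0 = n
  n2 : s.nreg 2 = 0
  n3 : s.nreg 3 = k
  n8 : s.nreg 8 = 1
  cost : s.rarr 1 = c

/-- The default argument checks that none of the constant cells is written, which makes the
environment available after each concrete program part. -/
theorem Env.frame {n k : ℕ} {c : ℕ → ℕ → ℝ} {s s' : Mem} (h : Env n k c s) {ts : List Cell}
    (hF : Frame ts s s')
    (hts : ∀ x ∈ [Cell.nr 0, .nr 2, .nr 3, .nr 8, .ra 1], x ∉ ts := by decide) : Env n k c s' := by
  refine ⟨?_, ?_, ?_, ?_, ?_⟩
  · rw [hF.nreg 0 (hts _ (by simp)), h.n0]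
  · rw [hF.nreg 2 (hts _ (by simp)), h.n2]
  · rw [hF.nreg 3 (hts _ (by simp)), h.n3]
  · rw [hF.nreg 8 (hts _ (by simp)), h.n8]
  · rw [hF.rarr 1 (hts _ (by simp)), h.cost]

variable {n k : ℕ} {c : ℕ → ℕ → ℝ} {s : Mem}

theorem runs_shiftRows (h : Env n k c s) :
    Runs shiftRows s (n * 12 + 2) fun s' => s'.rarr 2 0 = upto n
      (fun r => if s.narr 6 0 r = 0 then s.rarr 2 0 r else s.rarr 2 0 r + s.rreg 1)
      (s.rarr 2 0) := by
  refine Runs.forLoop (T := 10) (fun j s' => s'.rarr 2 0 = upto j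
      (fun r => if s.narr 6 0 r = 0 then s.rarr 2 0 r else s.rarr 2 0 r + s.rreg 1)
      (s.rarr 2 0)) (by decide) (by decide) h.n0 (by rw [upto_zero]; rfl) ?_ (fun s' _ h => h)
  intro j s' hj h9 hF hI
  have h' := h.frame hF
  have h6 := hF.narr 6 (by decide)
  have hx1 := hF.rreg 1 (by decide)
  refine Runs.cons (Runs.ite (fun hb => Runs.instr ?_) (fun hb =>
    Runs.cons (Runs.cons (Runs.instr ?_))))
  · simp [Test.Holds, Instr.apply, h9, h'.n2, h6] at hb
    simp only [Instr.apply, Mem.setN]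
    rw [hI, upto_succ]
    simp [hb]
  · simp [Test.Holds, Instr.apply, h9, h'.n2, h6] at hb
    simp [Instr.apply, Mem.setN, h9, h'.n2, setCell_row]
    rw [hI, update_upto]
    simp [hb, upto_self, hx1]

theorem runs_shiftColumns (h : Env n k c s) :
    Runs shiftColumns s (k * 12 + 2) fun s' =>
      s'.rarr 3 0 = upto k
        (fun j => if s.narr 5 0 j = 0 then s.rarr 3 0 j else s.rarr 3 0 j - s.rreg 1)
        (s.rarr 3 0) ∧
      s'.rarr 4 0 = upto k
        (fun j => if s.narr 5 0 j = 0 then s.rarr 4 0 j - s.rreg 1 else s.rarr 4 0 j)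
        (s.rarr 4 0) := by
  refine Runs.forLoop (T := 10) (fun j s' =>
      s'.rarr 3 0 = upto j
        (fun j => if s.narr 5 0 j = 0 then s.rarr 3 0 j else s.rarr 3 0 j - s.rreg 1)
        (s.rarr 3 0) ∧
      s'.rarr 4 0 = upto j
        (fun j => if s.narr 5 0 j = 0 then s.rarr 4 0 j - s.rreg 1 else s.rarr 4 0 j)
        (s.rarr 4 0)) (by decide) (by decide) h.n3
    (by rw [upto_zero, upto_zero]; exact ⟨rfl, rfl⟩) ?_ (fun s' _ h => h)
  rintro j s' hj h9 hF ⟨hI, hI'⟩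
  have h' := h.frame hF
  have h5 := hF.narr 5 (by decide)
  have hx1 := hF.rreg 1 (by decide)
  refine Runs.cons (Runs.ite (fun hb => Runs.cons (Runs.cons (Runs.instr ?_))) (fun hb =>
    Runs.cons (Runs.cons (Runs.instr ?_))))
  · simp [Test.Holds, Instr.apply, h9, h'.n2, h5] at hb
    simp [Instr.apply, Mem.setN, h9, h'.n2, setCell_row, setCell_of_ne]
    rw [hI, hI', update_upto, upto_succ]
    · exact ⟨rfl, rfl⟩
    · simp [hb]
    · simp [hb, upto_self, hx1]
  · simp [Test.Holds, Instr.apply, h9, h'.n2, h5] at hb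
    simp [Instr.apply, Mem.setN, h9, h'.n2, setCell_row, setCell_of_ne]
    rw [hI, hI', update_upto]
    · exact ⟨rfl, (upto_succ (by simp [hb])).symm⟩
    · simp [hb, upto_self, hx1]

theorem runs_relaxColumns (h : Env n k c s) {e j₁ : ℕ} (he : s.nreg 6 = e) (hj₁ : s.nreg 5 = j₁) :
    Runs relaxColumns s (k * 17 + 2) fun s' =>
      s'.rarr 4 0 = upto k
        (fun j => if s.narr 5 0 j = 0 ∧ c e j - s.rarr 2 0 e - s.rarr 3 0 j < s.rarr 4 0 j then
          c e j - s.rarr 2 0 e - s.rarr 3 0 j else s.rarr 4 0 j) (s.rarr 4 0) ∧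
      s'.narr 4 0 = upto k
        (fun j => if s.narr 5 0 j = 0 ∧ c e j - s.rarr 2 0 e - s.rarr 3 0 j < s.rarr 4 0 j then
          j₁ else s.narr 4 0 j) (s.narr 4 0) := by
  refine Runs.forLoop (T := 15) (fun j s' =>
      s'.rarr 4 0 = upto j
        (fun j => if s.narr 5 0 j = 0 ∧ c e j - s.rarr 2 0 e - s.rarr 3 0 j < s.rarr 4 0 j then
          c e j - s.rarr 2 0 e - s.rarr 3 0 j else s.rarr 4 0 j) (s.rarr 4 0) ∧
      s'.narr 4 0 = upto j
        (fun j => if s.narr 5 0 j = 0 ∧ c e j - s.rarr 2 0 e - s.rarr 3 0 j < s.rarr 4 0 j then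
          j₁ else s.narr 4 0 j) (s.narr 4 0)) (by decide) (by decide) h.n3
    (by rw [upto_zero, upto_zero]; exact ⟨rfl, rfl⟩) ?_ (fun s' _ h => h)
  rintro j s' hj h9 hF ⟨hI, hI'⟩
  have h' := h.frame hF
  have h5 := hF.narr 5 (by decide)
  have hu := hF.rarr 2 (by decide)
  have hv := hF.rarr 3 (by decide)
  have hr6 := (hF.nreg 6 (by decide)).trans he
  have hr5 := (hF.nreg 5 (by decide)).trans hj₁
  refine Runs.cons (Runs.ite (fun hb => Runs.cons (Runs.cons (Runs.cons (Runs.cons (Runs.cons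
    (Runs.cons (Runs.ite (fun hb' => Runs.cons (Runs.instr ?_)) (fun hb' => Runs.instr ?_))))))))
    (fun hb => Runs.instr ?_))
  · simp [Test.Holds, Instr.apply, h9, h'.n2, h5] at hb
    simp [Test.Holds, Instr.apply, h9, h'.n2, h'.cost, hr6, hu, hv, hI, upto_self] at hb'
    simp [Instr.apply, Mem.setN, h9, h'.n2, h'.cost, hr6, hr5, hu, hv, setCell_row]
    rw [hI, hI', update_upto, update_upto]
    · exact ⟨rfl, rfl⟩
    · simp [hb, hb']
    · simp [hb, hb']
  · simp [Test.Holds, Instr.apply, h9, h'.n2, h5] at hb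
    simp [Test.Holds, Instr.apply, h9, h'.n2, h'.cost, hr6, hu, hv, hI, upto_self] at hb'
    simp only [Instr.apply, Mem.setN]
    rw [hI, hI', upto_succ, upto_succ]
    · exact ⟨rfl, rfl⟩
    · simp [not_lt.2 hb']
    · simp [not_lt.2 hb']
  · simp [Test.Holds, Instr.apply, h9, h'.n2, h5] at hb
    simp only [Instr.apply, Mem.setN]
    rw [hI, hI', upto_succ, upto_succ]
    · exact ⟨rfl, rfl⟩
    · simp [hb]
    · simp [hb]

theorem runs_selectColumn (h : Env n k c s) (hex : ∃ j < k, s.narr 5 0 j = 0) :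
    Runs selectColumn s (k * 12 + 3) fun s' => s'.nreg 5 < k ∧ s.narr 5 0 (s'.nreg 5) = 0 ∧
      s'.rreg 1 = s.rarr 4 0 (s'.nreg 5) ∧
      ∀ j < k, s.narr 5 0 j = 0 → s'.rreg 1 ≤ s.rarr 4 0 j := by
  -- In the invariant, `k` in register `5` means that no unmarked column has been seen; otherwise
  -- registers `5` and `1` hold the position and value of the minimum so far.
  refine Runs.cons (Runs.forLoop (T := 10) (fun l s' =>
      (s'.nreg 5 = k ∧ ∀ j < l, s.narr 5 0 j ≠ 0) ∨
      (s'.nreg 5 < l ∧ s.narr 5 0 (s'.nreg 5) = 0 ∧ s'.rreg 1 = s.rarr 4 0 (s'.nreg 5) ∧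
        ∀ j < l, s.narr 5 0 j = 0 → s'.rreg 1 ≤ s.rarr 4 0 j)) (by decide) (by decide)
    (K := k) (by simp [Instr.apply, h.n3]) (Or.inl ?_) ?_ ?_)
  · simp [Instr.apply, Mem.setN, h.n3]
  · intro j s' hj h9 hF hI
    have hF' : Frame (Cell.nr 5 :: Cell.nr 9 :: _) s s' :=
      ((Instr.frame (.ncopy 5 3) s).mono (by simp [Instr.target])).trans
        (hF.mono (List.subset_cons_self _ _))
    have h' := h.frame hF'
    have h5 := hF'.narr 5 (by decide)
    have h4 := hF'.rarr 4 (by decide)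
    -- the new column becomes the current one
    have take : s.narr 5 0 j = 0 →
        (s'.nreg 5 < j → s.rarr 4 0 j < s'.rreg 1) →
        (j < k ∧ s.narr 5 0 j = 0 ∧ ∀ l < j + 1, s.narr 5 0 l = 0 →
          s.rarr 4 0 j ≤ s.rarr 4 0 l) := by
      intro hu hlt
      refine ⟨hj, hu, fun l hl hul => ?_⟩
      rcases (Nat.lt_succ_iff.1 hl).lt_or_eq with hl' | rfl
      · rcases hI with ⟨-, hI⟩ | ⟨hI1, -, -, hI⟩
        · exact absurd hul (hI l hl')
        · exact (hlt hI1).le.trans (hI l hl' hul)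
      · exact le_rfl
    refine Runs.cons (Runs.ite (fun hb => Runs.cons (Runs.ite (fun hb₁ => Runs.ite
      (fun hb₂ => Runs.cons (Runs.instr ?_)) (fun hb₂ => Runs.instr ?_))
      (fun hb₁ => Runs.cons (Runs.instr ?_)))) (fun hb => Runs.instr ?_))
    · simp [Test.Holds, Instr.apply, h9, h'.n2, h5, h4] at hb hb₂
      have := take hb (fun _ => hb₂)
      right
      simpa [Instr.apply, Mem.setN, h9, h'.n2, h4, hb] using this.2.2
    · simp [Test.Holds, Instr.apply, h9, h'.n2, h'.n3, h5, h4] at hb hb₁ hb₂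
      rcases hI with hI | ⟨hI1, hI2, hI3, hI⟩
      · omega
      · right
        simp [Instr.apply, Mem.setN]
        refine ⟨by omega, hI2, hI3, fun l hl hul => ?_⟩
        rcases hl.lt_or_eq with hl' | rfl
        · exact hI l hl' hul
        · exact hb₂
    · simp [Test.Holds, Instr.apply, h9, h'.n2, h'.n3, h5, h4] at hb hb₁
      have := take hb (fun _ => by omega)
      right
      simpa [Instr.apply, Mem.setN, h9, h'.n2, h4, hb] using this.2.2
    · simp [Test.Holds, Instr.apply, h9, h'.n2, h5] at hb
      simp [Instr.apply, Mem.setN]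
      rcases hI with ⟨hI1, hI⟩ | ⟨hI1, hI2, hI3, hI⟩
      · left
        refine ⟨hI1, fun l hl => ?_⟩
        rcases hl.lt_or_eq with hl' | rfl
        · exact hI l hl'
        · exact hb
      · right
        refine ⟨by omega, hI2, hI3, fun l hl hul => ?_⟩
        rcases hl.lt_or_eq with hl' | rfl
        · exact hI l hl' hul
        · exact absurd hul hb
  · rintro s' - (⟨-, hI⟩ | hI)
    · obtain ⟨j, hj, hj'⟩ := hex
      exact absurd hj' (hI j hj)
    · exact hI

end StructCtrl

/-! ### Inserting one row: search and augmentation -/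

namespace StructCtrl

variable {n k : ℕ} {c : ℕ → ℕ → ℝ} {s : Mem}

/-- Changes the dual variables so that a new edge becomes tight, and extends the search tree by it
unless its column is free. -/
def searchStep : Prog :=
  selectColumn ;; shiftRows ;; shiftColumns ;;
  .instr (.nload 6 3 2 5) ;;
  .ite (.nlt 6 0)
    (.instr (.nstore 5 2 5 8) ;; .instr (.nstore 6 2 6 8) ;; relaxColumns)
    (.instr (.nconst 7 1))

/-- The arrays in the memory form a search tree for the row `i`. -/
def TreeAt (n k : ℕ) (c : ℕ → ℕ → ℝ) (i : ℕ) (s : Mem) (ord : ℕ → ℕ) (q : ℕ) : Prop :=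
  SearchTree n k c i (s.rarr 2 0) (s.rarr 3 0) (s.narr 3 0) (s.narr 4 0) (s.narr 5 0)
    (s.narr 6 0) (s.rarr 4 0) ord q

/-- The register `5` holds a free column that is joined to the tree by a tight edge. -/
def FreeColumnAt (n k : ℕ) (s : Mem) : Prop :=
  s.nreg 5 < k ∧ s.narr 5 0 (s.nreg 5) = 0 ∧ s.rarr 4 0 (s.nreg 5) = 0 ∧
    s.narr 3 0 (s.nreg 5) = n

/-- The selected column has slack zero after the shift by its own slack. If it is matched, it and
its row join the tree and the slacks are relaxed through that row; if it is free, the flag is set.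
-/
theorem runs_searchStep (h : Env n k c s) (hnk : n ≤ k) {i : ℕ} {ord : ℕ → ℕ} {q : ℕ}
    (ht : TreeAt n k c i s ord q) :
    Runs searchStep s (n * 12 + k * 41 + 20) fun s' =>
      (s'.nreg 7 = s.nreg 7 ∧ ∃ ord', TreeAt n k c i s' ord' (q + 1)) ∨
      (s'.nreg 7 = 1 ∧ TreeAt n k c i s' ord q ∧ FreeColumnAt n k s') := by
  have hT : (k * 12 + 3) + ((n * 12 + 2) + ((k * 12 + 2) + ((k * 17 + 2 + 2) + 1 + 1)))
      ≤ n * 12 + k * 41 + 20 := by omega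
  refine Runs.mono (Runs.seq (runs_selectColumn h (ht.exists_unused hnk)) fun s₁ hF₁ h₁ =>
    Runs.seq (runs_shiftRows (h.frame hF₁)) fun s₂ hF₂ h₂ =>
    Runs.seq (runs_shiftColumns ((h.frame hF₁).frame hF₂)) fun s₃ hF₃ h₃ =>
    Runs.cons (Runs.ite (fun hb => Runs.cons (Runs.cons ?_)) (fun hb => Runs.instr ?_)))
    hT (fun _ _ h => h)
  all_goals
    have e₃ := ((h.frame hF₁).frame hF₂).frame hF₃
    obtain ⟨hj, hju, hδ, hmin⟩ := h₁
    obtain ⟨h3v, h3m⟩ := h₃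
    have p3 : s₃.narr 3 = s.narr 3 := by
      rw [hF₃.narr 3 (by decide), hF₂.narr 3 (by decide), hF₁.narr 3 (by decide)]
    have p4 : s₃.narr 4 = s.narr 4 := by
      rw [hF₃.narr 4 (by decide), hF₂.narr 4 (by decide), hF₁.narr 4 (by decide)]
    have p5 : s₃.narr 5 = s.narr 5 := by
      rw [hF₃.narr 5 (by decide), hF₂.narr 5 (by decide), hF₁.narr 5 (by decide)]
    have p6 : s₃.narr 6 = s.narr 6 := by
      rw [hF₃.narr 6 (by decide), hF₂.narr 6 (by decide), hF₁.narr 6 (by decide)]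
    have pu := (congrFun (hF₃.rarr 2 (by decide)) 0).trans h₂
    rw [hF₂.rarr 3 (by decide), hF₁.rarr 3 (by decide), hF₂.narr 5 (by decide),
      hF₁.narr 5 (by decide), hF₂.rreg 1 (by decide)] at h3v
    rw [hF₂.rarr 4 (by decide), hF₁.rarr 4 (by decide), hF₂.narr 5 (by decide),
      hF₁.narr 5 (by decide), hF₂.rreg 1 (by decide)] at h3m
    rw [hF₁.rarr 2 (by decide), hF₁.narr 6 (by decide)] at pu
    have r5 : s₃.nreg 5 = s₁.nreg 5 := by
      rw [hF₃.nreg 5 (by decide), hF₂.nreg 5 (by decide)]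
    have r7 : s₃.nreg 7 = s.nreg 7 := by
      rw [hF₃.nreg 7 (by decide), hF₂.nreg 7 (by decide), hF₁.nreg 7 (by decide)]
    have ht₃ : TreeAt n k c i s₃ ord q := by
      have := ht.shift (δ := s₁.rreg 1) (by rw [hδ]; exact ht.minv_nonneg hj hju) hmin
        (u' := s₃.rarr 2 0) (v' := s₃.rarr 3 0) (minv' := s₃.rarr 4 0)
        (fun r hr => by rw [pu, upto_of_lt _ _ hr])
        (fun j hj => by rw [h3v, upto_of_lt _ _ hj])
        (fun j hj hu => by rw [h3m, upto_of_lt _ _ hj, if_pos hu])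
      rwa [TreeAt, p3, p4, p5, p6]
    have hju₃ : s₃.narr 5 0 (s₃.nreg 5) = 0 := by rw [r5, p5, hju]
    have hjm₃ : s₃.rarr 4 0 (s₃.nreg 5) = 0 := by
      rw [r5, h3m, upto_of_lt _ _ hj, if_pos hju, hδ, sub_self]
    rw [← r5] at hj
    simp [Test.Holds, Instr.apply, e₃.n2, e₃.n0] at hb
  · refine Runs.mono (runs_relaxColumns (n := n) (k := k) (c := c) (e := s₃.narr 3 0 (s₃.nreg 5))
      (j₁ := s₃.nreg 5) ?_ ?_ ?_) le_rfl ?_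
    · constructor <;> simp [Instr.apply, e₃.n0, e₃.n2, e₃.n3, e₃.n8, e₃.cost]
    · simp [Instr.apply, e₃.n2]
    · simp [Instr.apply]
    · rintro s₄ hF₄ ⟨hm, hw⟩
      left
      have q2 := hF₄.rarr 2 (by decide)
      have q3 := hF₄.rarr 3 (by decide)
      have q5 := hF₄.narr 5 (by decide)
      have q6 := hF₄.narr 6 (by decide)
      have qp := hF₄.narr 3 (by decide)
      have q7 := hF₄.nreg 7 (by decide)
      simp [Instr.apply, e₃.n2, e₃.n8, setCell_row, setCell_of_ne] at q2 q3 q5 q6 qp q7 hm hw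
      refine ⟨by rw [q7, r7], Function.update ord (s₃.nreg 5) q, ?_⟩
      have := ht₃.grow hj hju₃ hjm₃ hb (way' := s₄.narr 4 0) (minv' := s₄.rarr 4 0)
        (fun j hj => by rw [hw, upto_of_lt _ _ hj]) (fun j hj => by rw [hm, upto_of_lt _ _ hj])
      rw [TreeAt, q2, q3, q5, q6, qp, setCell_row, setCell_row,
        setCell_of_ne _ _ _ _ (by decide : 6 ≠ 5)]
      exact this
  · right
    refine ⟨by simp [Instr.apply], ht₃, ?_⟩
    have hp : s₃.narr 3 0 (s₃.nreg 5) = n := by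
      rcases ht₃.range _ hj with h1 | h1
      · have := ht.row_lt
        omega
      · exact h1
    simp [FreeColumnAt, Instr.apply]
    exact ⟨hj, hju₃, hjm₃, hp⟩

/-- Extends the search tree until a free column is reached. -/
def search : Prog := .instr (.nconst 7 0) ;; .loop (.neq 7 2) searchStep

/-- While the flag is `0`, the measure is `n - q`, and every step that does not set the flag adds a
column; since `q ≤ i < n` it decreases. Once the flag is set, only the final failing test remains.
-/
theorem runs_search (h : Env n k c s) (hnk : n ≤ k) {i : ℕ} {ord : ℕ → ℕ} {q : ℕ}
    (ht : TreeAt n k c i s ord q) :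
    Runs search s (n * (n * 12 + k * 41 + 21) + 2) fun s' =>
      ∃ ord' q', TreeAt n k c i s' ord' q' ∧ FreeColumnAt n k s' := by
  have key := Runs.loop (b := .neq 7 2) (p := searchStep) (T := n * 12 + k * 41 + 20)
    (s := (Instr.nconst 7 0).apply s) (n := n - q)
    (Q := fun s' => ∃ ord' q', TreeAt n k c i s' ord' q' ∧ FreeColumnAt n k s')
    (fun b s' => ∃ ord' q', TreeAt n k c i s' ord' q' ∧
      ((s'.nreg 7 = 0 ∧ b = n - q') ∨ (s'.nreg 7 = 1 ∧ FreeColumnAt n k s')))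
    ⟨ord, q, ht, Or.inl ⟨by simp [Instr.apply], rfl⟩⟩ ?_ ?_
  · refine (Runs.cons key).mono ?_ (fun _ _ h => h)
    have : (n - q) * (n * 12 + k * 41 + 20 + 1) ≤ n * (n * 12 + k * 41 + 21) :=
      Nat.mul_le_mul_right _ (Nat.sub_le _ _)
    omega
  · rintro b s' hF ⟨ord', q', ht', h7⟩ hb
    have h₁ : Env n k c ((Instr.nconst 7 0).apply s) := h.frame (Instr.frame _ s)
    have h' := h₁.frame hF
    simp only [Test.Holds, h'.n2] at hb
    rcases h7 with ⟨-, rfl⟩ | ⟨h7, -⟩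
    · refine (runs_searchStep h' hnk ht').mono le_rfl ?_
      have hq := ht'.card_le
      have hi := ht'.row_lt
      rintro s'' - (⟨h8, ord'', ht''⟩ | ⟨h8, ht'', hfree⟩)
      · exact ⟨n - (q' + 1), by omega, ord'', q' + 1, ht'', Or.inl ⟨h8.trans hb, rfl⟩⟩
      · exact ⟨0, by omega, ord', q', ht'', Or.inr ⟨h8, hfree⟩⟩
    · omega
  · rintro b s' hF ⟨ord', q', ht', h7⟩ hb
    have h₁ : Env n k c ((Instr.nconst 7 0).apply s) := h.frame (Instr.frame _ s)
    have h' := h₁.frame hF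
    simp only [Test.Holds, h'.n2] at hb
    rcases h7 with ⟨h7, -⟩ | ⟨-, h7⟩
    · exact absurd h7 hb
    · exact ⟨ord', q', ht', h7⟩

/-- Changes the assignment along the path to the free column. -/
def augment : Prog :=
  .loop (.nlt 5 3)
    (.instr (.nload 10 4 2 5) ;; .instr (.nload 11 3 2 10) ;; .instr (.nstore 3 2 5 11) ;;
      .instr (.ncopy 5 10))

/-- The time bound `b` of `Augmenting` serves as the loop measure. It starts at `q + 1 ≤ n` and
drops to the entry time of the old hole. -/
theorem runs_augment (h : Env n k c s) {i : ℕ} {ord : ℕ → ℕ} {q : ℕ}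
    (ht : TreeAt n k c i s ord q) (hfree : FreeColumnAt n k s) :
    Runs augment s (n * 11 + 1) fun s' =>
      DualPair n k c (i + 1) (s'.rarr 2 0) (s'.rarr 3 0) (s'.narr 3 0) := by
  obtain ⟨hj, hu, hm, hp⟩ := hfree
  have key := Runs.loop (b := .nlt 5 3) (T := 10) (s := s) (n := q + 1)
    (Q := fun s' => DualPair n k c (i + 1) (s'.rarr 2 0) (s'.rarr 3 0) (s'.narr 3 0))
    (p := .instr (.nload 10 4 2 5) ;; .instr (.nload 11 3 2 10) ;; .instr (.nstore 3 2 5 11) ;;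
      .instr (.ncopy 5 10))
    (fun b s' => Augmenting n k c i (s'.rarr 2 0) (s'.rarr 3 0) (s'.narr 3 0) (s'.narr 4 0)
      (fun j => s.narr 5 0 j ≠ 0 ∨ j = s.nreg 5) (Function.update ord (s.nreg 5) q) (s'.nreg 5) b)
    (ht.augmenting hj hu hm hp) ?_ ?_
  · refine Runs.mono key ?_ (fun _ _ h => h)
    have := ht.card_le
    have := ht.row_lt
    have : (q + 1) * (10 + 1) ≤ n * 11 := Nat.mul_le_mul_right 11 (by omega)
    omega
  · intro b s' hF hA hb
    have h' := h.frame hF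
    simp only [Test.Holds, h'.n3] at hb
    obtain ⟨hA', hlt⟩ := hA.step hb
    refine Runs.cons (Runs.cons (Runs.cons (Runs.instr ⟨_, hlt, ?_⟩)))
    simpa [Instr.apply, h'.n2, setCell_row, setCell_of_ne] using hA'
  · intro b s' hF hA hb
    have h' := h.frame hF
    simp only [Test.Holds, h'.n3] at hb
    exact hA.dualPair hb

/-- Unmarks all rows. -/
def resetRows : Prog := forLoop 9 0 (.instr (.nstore 6 2 9 2))

/-- Unmarks all columns and initialises their slacks and predecessors. -/
def resetColumns : Prog :=
  forLoop 9 3 (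
    .instr (.nstore 5 2 9 2) ;; .instr (.nstore 4 2 9 3) ;;
    .instr (.rload 2 1 4 9) ;; .instr (.rload 3 2 2 4) ;; .instr (.rsub 2 2 3) ;;
    .instr (.rload 3 3 2 9) ;; .instr (.rsub 2 2 3) ;; .instr (.rstore 4 2 9 2))

theorem runs_resetRows (h : Env n k c s) :
    Runs resetRows s (n * 3 + 2) fun s' => s'.narr 6 0 = upto n 0 (s.narr 6 0) := by
  refine Runs.forLoop (T := 1) (fun j s' => s'.narr 6 0 = upto j 0 (s.narr 6 0)) (by decide)
    (by decide) h.n0 (by rw [upto_zero]; rfl) ?_ (fun s' _ h => h)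
  intro j s' hj h9 hF hI
  have h' := h.frame hF
  refine Runs.instr ?_
  simp [Instr.apply, Mem.setN, h9, h'.n2, setCell_row]
  rw [hI, update_upto]
  rfl

theorem runs_resetColumns (h : Env n k c s) {i : ℕ} (hi : s.nreg 4 = i) :
    Runs resetColumns s (k * 12 + 2) fun s' => s'.narr 5 0 = upto k 0 (s.narr 5 0) ∧
      s'.narr 4 0 = upto k (fun _ => k) (s.narr 4 0) ∧
      s'.rarr 4 0 = upto k (fun j => c i j - s.rarr 2 0 i - s.rarr 3 0 j) (s.rarr 4 0) := by
  refine Runs.forLoop (T := 10) (fun l s' => s'.narr 5 0 = upto l 0 (s.narr 5 0) ∧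
      s'.narr 4 0 = upto l (fun _ => k) (s.narr 4 0) ∧
      s'.rarr 4 0 = upto l (fun j => c i j - s.rarr 2 0 i - s.rarr 3 0 j) (s.rarr 4 0))
    (by decide) (by decide) h.n3 (by simp only [upto_zero]; exact ⟨rfl, rfl, rfl⟩) ?_
    (fun s' _ h => h)
  rintro j s' hj h9 hF ⟨hI₁, hI₂, hI₃⟩
  have h' := h.frame hF
  have hu := hF.rarr 2 (by decide)
  have hv := hF.rarr 3 (by decide)
  have hr4 := (hF.nreg 4 (by decide)).trans hi
  refine Runs.cons (Runs.cons (Runs.cons (Runs.cons (Runs.cons (Runs.cons (Runs.cons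
    (Runs.instr ?_)))))))
  simp [Instr.apply, Mem.setN, h9, h'.n2, h'.n3, h'.cost, hu, hv, hr4, setCell_row, setCell_of_ne]
  rw [hI₁, hI₂, hI₃]
  exact ⟨update_upto rfl, update_upto rfl, update_upto rfl⟩

/-- Assigns a column to the row in register `4`. -/
def insertRow : Prog :=
  .instr (.nstore 3 2 3 4) ;; resetRows ;; .instr (.nstore 6 2 4 8) ;; resetColumns ;;
  search ;; augment

/-- The search repeats a linear step at most `n` times and dominates the cost, which is quadratic
per row; everything else is linear. -/
theorem runs_insertRow (h : Env n k c s) (hnk : n ≤ k) {i : ℕ} (hi : i < n) (h4 : s.nreg 4 = i)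
    (hd : DualPair n k c i (s.rarr 2 0) (s.rarr 3 0) (s.narr 3 0)) :
    Runs insertRow s (n * (n * 12 + k * 41 + 40) + k * 12 + 20) fun s' =>
      DualPair n k c (i + 1) (s'.rarr 2 0) (s'.rarr 3 0) (s'.narr 3 0) := by
  have hT : (n * 3 + 2) + ((k * 12 + 2) + ((n * (n * 12 + k * 41 + 21) + 2) + (n * 11 + 1)) + 1)
      + 1 ≤ n * (n * 12 + k * 41 + 40) + k * 12 + 20 := by
    have : n * (n * 12 + k * 41 + 40) = n * (n * 12 + k * 41 + 21) + n * 19 := by ring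
    omega
  have e₀ : Env n k c ((Instr.nstore 3 2 3 4).apply s) := h.frame (Instr.frame _ s)
  refine Runs.mono (Runs.cons (Runs.seq (runs_resetRows e₀) fun s₁ hF₁ h₁ => Runs.cons
    (Runs.seq (runs_resetColumns (n := n) (k := k) (c := c) (i := i)
      ((e₀.frame hF₁).frame (Instr.frame _ s₁)) ?_) fun s₂ hF₂ h₂ =>
    Runs.seq (runs_search (i := i) (ord := 0) (q := 0)
      (((e₀.frame hF₁).frame (Instr.frame _ s₁)).frame hF₂) hnk ?_) fun s₃ hF₃ h₃ => ?_)))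
    hT (fun _ _ h => h)
  · simp [Instr.apply, hF₁.nreg 4 (by decide), h4]
  · have e₁ := e₀.frame hF₁
    have r4 : s₁.nreg 4 = i := by
      rw [hF₁.nreg 4 (by decide)]
      simp [Instr.apply, h4]
    have a3 := hF₂.narr 3 (by decide)
    have a6 := hF₂.narr 6 (by decide)
    have a2 := hF₂.rarr 2 (by decide)
    have av := hF₂.rarr 3 (by decide)
    have b3 := hF₁.narr 3 (by decide)
    have b2 := hF₁.rarr 2 (by decide)
    have bv := hF₁.rarr 3 (by decide)
    obtain ⟨k5, k4, km⟩ := h₂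
    simp [Instr.apply, e₁.n2, e₁.n8, h.n2, h.n3, h4, r4, setCell_of_ne]
      at a3 a6 a2 av b3 b2 bv k5 k4 km
    rw [b2] at a2
    rw [bv] at av
    have p3 : s₂.narr 3 0 = Function.update (s.narr 3 0) k i := by
      rw [a3, b3, setCell_row]
    have p6 : s₂.narr 6 0 = Function.update (s₁.narr 6 0) i 1 := by
      rw [a6, setCell_row]
    rw [← a2, ← av] at hd
    refine hd.searchTree hi ?_ ?_ ?_ ?_ ?_ ?_
    · intro j hj
      rw [p3, Function.update_of_ne hj.ne]
    · rw [p3, Function.update_self]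
    · intro j hj
      rw [k4, upto_of_lt _ _ hj]
    · intro j hj
      rw [k5, upto_of_lt _ _ hj]
      rfl
    · intro r hr
      rw [p6, h₁]
      by_cases hri : r = i
      · simp [hri]
      · simp [hri, upto_of_lt _ _ hr]
    · intro j hj
      rw [km, upto_of_lt _ _ hj, a2, av, b2, bv]
  · obtain ⟨ord', q', ht, hfree⟩ := h₃
    exact runs_augment ((((e₀.frame hF₁).frame (Instr.frame _ s₁)).frame hF₂).frame hF₃) ht hfree

/-- Assigns columns to all the rows. -/
def hungarian : Prog := forLoop 4 0 insertRow

theorem runs_hungarian (h : Env n k c s) (hnk : n ≤ k)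
    (hd : DualPair n k c 0 (s.rarr 2 0) (s.rarr 3 0) (s.narr 3 0)) :
    Runs hungarian s (n * (n * (n * 12 + k * 41 + 40) + k * 12 + 22) + 2) fun s' =>
      DualPair n k c n (s'.rarr 2 0) (s'.rarr 3 0) (s'.narr 3 0) := by
  refine Runs.forLoop (T := n * (n * 12 + k * 41 + 40) + k * 12 + 20) (fun i s' =>
    DualPair n k c i (s'.rarr 2 0) (s'.rarr 3 0) (s'.narr 3 0)) (by decide) (by decide) h.n0 hd ?_
    (fun s' _ h => h)
  intro i s' hi h4 hF hI
  exact (runs_insertRow (h.frame hF) hnk hi h4 hI).mono le_rfl fun _ _ h => h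

end StructCtrl

namespace StructCtrl

/-! ### The complete program -/

section Setup

variable {d m : ℕ} {s : Mem}

/-- Puts the number of columns into register `3` and the constant `1` into register `8`. -/
def computeWidth : Prog :=
  .instr (.nconst 8 1) ;; .instr (.ncopy 3 0) ;; forLoop 9 1 (.instr (.ninc 3))

theorem runs_computeWidth (h0 : s.nreg 0 = d) (h1 : s.nreg 1 = m) :
    Runs computeWidth s (m * 3 + 4) fun s' => s'.nreg 3 = d + m ∧ s'.nreg 8 = 1 := by
  refine Runs.cons (Runs.cons (Runs.forLoop (T := 1) (K := m)
    (fun j s' => s'.nreg 3 = d + j ∧ s'.nreg 8 = 1) (by decide) (by decide)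
    (by simp [Instr.apply, h1]) (by simp [Instr.apply, Mem.setN, h0]) ?_ (fun s' _ h => h)))
  rintro j s' hj h9 hF ⟨hI, hI'⟩
  refine Runs.instr ?_
  simp [Instr.apply, Mem.setN, hI, hI', Nat.add_assoc]

/-- Adds the costs of one row to the real register `0`. -/
def addRowCosts : Prog :=
  forLoop 10 1 (
    .instr (.nload 11 1 9 10) ;;
    .ite (.neq 11 8) (.instr (.rload 2 0 9 10) ;; .instr (.radd 0 0 2)) noop)

theorem runs_addRowCosts {r : ℕ} (h1 : s.nreg 1 = m) (h8 : s.nreg 8 = 1) (h9 : s.nreg 9 = r) :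
    Runs addRowCosts s (m * 12 + 2) fun s' => s'.rreg 0 =
      s.rreg 0 + ∑ j ∈ Finset.range m, if s.narr 1 r j = 1 then s.rarr 0 r j else 0 := by
  refine Runs.forLoop (T := 10) (fun l s' => s'.rreg 0 = s.rreg 0 +
      ∑ j ∈ Finset.range l, if s.narr 1 r j = 1 then s.rarr 0 r j else 0)
    (by decide) (by decide) h1 (by simp [Mem.setN]) ?_ (fun s' _ h => h)
  intro j s' hj h10 hF hI
  have r8 := (hF.nreg 8 (by decide)).trans h8
  have r9 := (hF.nreg 9 (by decide)).trans h9
  have hB := hF.narr 1 (by decide)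
  have hw := hF.rarr 0 (by decide)
  refine Runs.cons (Runs.ite (fun hb => Runs.cons (Runs.instr ?_)) (fun hb => Runs.instr ?_))
  · simp [Test.Holds, Instr.apply, r8, r9, h10, hB] at hb
    simp [Instr.apply, Mem.setN, r9, h10, hw, hI, Finset.sum_range_succ, hb, add_assoc]
  · simp [Test.Holds, Instr.apply, r8, r9, h10, hB] at hb
    simp [Instr.apply, Mem.setN, hI, Finset.sum_range_succ, hb]

/-- The sum of all costs plus one. -/
def computeBound : Prog := .instr (.rconst 0 1) ;; forLoop 9 0 addRowCosts

theorem runs_computeBound (h0 : s.nreg 0 = d) (h1 : s.nreg 1 = m) (h8 : s.nreg 8 = 1) :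
    Runs computeBound s (d * (m * 12 + 4) + 3) fun s' => s'.rreg 0 =
      1 + ∑ r ∈ Finset.range d, ∑ j ∈ Finset.range m,
        if s.narr 1 r j = 1 then s.rarr 0 r j else 0 := by
  refine Runs.cons (Runs.forLoop (T := m * 12 + 2) (K := d) (fun r s' => s'.rreg 0 =
      1 + ∑ r ∈ Finset.range r, ∑ j ∈ Finset.range m,
        if s.narr 1 r j = 1 then s.rarr 0 r j else 0) (by decide) (by decide)
    (by simp [Instr.apply, h0]) (by simp [Instr.apply, Mem.setN]) ?_ (fun s' _ h => h))
  intro r s' hr h9 hF hI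
  have r1 := hF.nreg 1 (by decide)
  have r8 := hF.nreg 8 (by decide)
  have hB := hF.narr 1 (by decide)
  have hw := hF.rarr 0 (by decide)
  simp [Instr.apply, h1, h8] at r1 r8 hB hw
  refine (runs_addRowCosts r1 r8 h9).mono le_rfl fun s'' _ h => ?_
  simp [Mem.setN, h, hI, hB, hw, Finset.sum_range_succ, add_assoc]

/-- Fills one row of the part of the cost table that belongs to the states. -/
def fillStateRow : Prog :=
  forLoop 10 0 (
    .instr (.nload 11 0 9 10) ;;
    .ite (.neq 11 8) (.instr (.rconst 2 0) ;; .instr (.rstore 1 9 10 2)) (.instr (.rstore 1 9 10 0)))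

theorem runs_fillStateRow {r : ℕ} (h0 : s.nreg 0 = d) (h8 : s.nreg 8 = 1) (h9 : s.nreg 9 = r) :
    Runs fillStateRow s (d * 12 + 2) fun s' =>
      s'.rarr 1 r = upto d (fun j => if s.narr 0 r j = 1 then 0 else s.rreg 0) (s.rarr 1 r) ∧
      ∀ r', r' ≠ r → s'.rarr 1 r' = s.rarr 1 r' := by
  refine Runs.forLoop (T := 10) (fun l s' =>
      s'.rarr 1 r = upto l (fun j => if s.narr 0 r j = 1 then 0 else s.rreg 0) (s.rarr 1 r) ∧
      ∀ r', r' ≠ r → s'.rarr 1 r' = s.rarr 1 r')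
    (by decide) (by decide) h0 (by simp [Mem.setN, upto_zero]) ?_ (fun s' _ h => h)
  rintro j s' hj h10 hF ⟨hI, hI'⟩
  have r8 := (hF.nreg 8 (by decide)).trans h8
  have r9 := (hF.nreg 9 (by decide)).trans h9
  have hA := hF.narr 0 (by decide)
  have hM := hF.rreg 0 (by decide)
  have hrow : ∀ (f : ℕ → ℕ → ℕ → ℝ) v r', r' ≠ r → setCell f 1 r j v 1 r' = f 1 r' := by
    intro f v r' hr'
    funext x
    simp [setCell, hr']
  refine Runs.cons (Runs.ite (fun hb => Runs.cons (Runs.instr ?_)) (fun hb => Runs.instr ?_))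
  · simp [Test.Holds, Instr.apply, r8, r9, h10, hA] at hb
    simp [Instr.apply, Mem.setN, r9, h10, setCell_row]
    rw [hI]
    refine ⟨update_upto (by simp [hb]), fun r' hr' => ?_⟩
    rw [hrow _ _ r' hr', hI' r' hr']
  · simp [Test.Holds, Instr.apply, r8, r9, h10, hA] at hb
    simp [Instr.apply, Mem.setN, r9, h10, setCell_row]
    rw [hI]
    refine ⟨update_upto (by simp [hb, hM]), fun r' hr' => ?_⟩
    rw [hrow _ _ r' hr', hI' r' hr']

/-- Fills the part of the cost table that belongs to the states. -/
def fillState : Prog := forLoop 9 0 fillStateRow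

theorem runs_fillState (h0 : s.nreg 0 = d) (h8 : s.nreg 8 = 1) :
    Runs fillState s (d * (d * 12 + 4) + 2) fun s' => ∀ r < d, ∀ j < d,
      s'.rarr 1 r j = if s.narr 0 r j = 1 then 0 else s.rreg 0 := by
  refine Runs.forLoop (T := d * 12 + 2) (fun l s' => ∀ r < l, ∀ j < d,
      s'.rarr 1 r j = if s.narr 0 r j = 1 then 0 else s.rreg 0)
    (by decide) (by decide) h0 (fun r hr => absurd hr (by omega)) ?_ (fun s' _ h => h)
  intro l s' hl h9 hF hI
  have r0 := (hF.nreg 0 (by decide)).trans h0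
  have r8 := (hF.nreg 8 (by decide)).trans h8
  refine (runs_fillStateRow r0 r8 h9).mono le_rfl ?_
  rintro s'' - ⟨h₁, h₂⟩ r hr j hj
  rw [hF.narr 0 (by decide), hF.rreg 0 (by decide)] at h₁
  change s''.rarr 1 r j = _
  by_cases hrl : r = l
  · rw [hrl, h₁, upto_of_lt _ _ hj]
  · rw [h₂ r hrl]
    exact hI r (by omega) j hj

/-- Fills one row of the part of the cost table that belongs to the inputs. -/
def fillInputRow : Prog :=
  .instr (.ncopy 12 0) ;;
  forLoop 10 1 (
    .instr (.nload 11 1 9 10) ;;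
    .ite (.neq 11 8)
      (.instr (.rload 2 0 9 10) ;; .instr (.rstore 1 9 12 2) ;; .instr (.ninc 12))
      (.instr (.rstore 1 9 12 0) ;; .instr (.ninc 12)))

/-- Natural registers cannot be added, so register `12` is counted along with the loop and holds the
shifted column `d + j`. -/
theorem runs_fillInputRow {r : ℕ} (h0 : s.nreg 0 = d) (h1 : s.nreg 1 = m) (h8 : s.nreg 8 = 1)
    (h9 : s.nreg 9 = r) :
    Runs fillInputRow s (m * 12 + 3) fun s' =>
      (∀ j < m, s'.rarr 1 r (d + j) = if s.narr 1 r j = 1 then s.rarr 0 r j else s.rreg 0) ∧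
      ∀ r' j, (r' ≠ r ∨ j < d) → s'.rarr 1 r' j = s.rarr 1 r' j := by
  refine Runs.cons ((Runs.forLoop (T := 10) (K := m) (fun l s' => s'.nreg 12 = d + l ∧
      (∀ j < l, s'.rarr 1 r (d + j) = if s.narr 1 r j = 1 then s.rarr 0 r j else s.rreg 0) ∧
      ∀ r' j, (r' ≠ r ∨ j < d) → s'.rarr 1 r' j = s.rarr 1 r' j)
    (by decide) (by decide) (by simp [Instr.apply, h1]) (by simp [Instr.apply, Mem.setN, h0]) ?_
    (fun s' _ h => h.2)))
  rintro l s' hl h10 hF ⟨h12, hI, hI'⟩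
  have r8 := hF.nreg 8 (by decide)
  have r9 := hF.nreg 9 (by decide)
  have hB := hF.narr 1 (by decide)
  have hw := hF.rarr 0 (by decide)
  have hM := hF.rreg 0 (by decide)
  simp [Instr.apply, h8, h9] at r8 r9 hB hw hM
  have hset : ∀ v, v = (if s.narr 1 r l = 1 then s.rarr 0 r l else s.rreg 0) →
      (∀ j < l + 1, setCell s'.rarr 1 r (d + l) v 1 r (d + j) =
        if s.narr 1 r j = 1 then s.rarr 0 r j else s.rreg 0) ∧
      ∀ r' j, (r' ≠ r ∨ j < d) → setCell s'.rarr 1 r (d + l) v 1 r' j = s.rarr 1 r' j := by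
    intro v hv
    constructor
    · intro j hj
      by_cases hjl : j = l
      · simp [setCell, hjl, hv]
      · rw [← hI j (by omega)]
        simp [setCell, hjl]
    · intro r' j hj
      rw [← hI' r' j hj]
      simp only [setCell]
      rw [if_neg]
      rintro ⟨-, h, h'⟩
      omega
  refine Runs.cons (Runs.ite (fun hb => Runs.cons (Runs.cons (Runs.instr ?_)))
    (fun hb => Runs.cons (Runs.instr ?_)))
  · simp [Test.Holds, Instr.apply, r8, r9, h10, hB] at hb
    have := hset (s.rarr 0 r l) (by simp [hb])
    simp only [Instr.apply, Mem.setN, ne_eq, Nat.reduceEqDiff, not_false_eq_true,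
      Function.update_of_ne, Function.update_self, r9, h10, h12, hw]
    exact ⟨by omega, this⟩
  · simp [Test.Holds, Instr.apply, r8, r9, h10, hB] at hb
    have := hset (s.rreg 0) (by simp [hb])
    simp only [Instr.apply, Mem.setN, ne_eq, Nat.reduceEqDiff, not_false_eq_true,
      Function.update_of_ne, Function.update_self, r9, h10, h12, hM]
    exact ⟨by omega, this⟩

/-- Fills the part of the cost table that belongs to the inputs. -/
def fillInput : Prog := forLoop 9 0 fillInputRow

theorem runs_fillInput (h0 : s.nreg 0 = d) (h1 : s.nreg 1 = m) (h8 : s.nreg 8 = 1) :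
    Runs fillInput s (d * (m * 12 + 5) + 2) fun s' => (∀ r < d, ∀ j < m,
      s'.rarr 1 r (d + j) = if s.narr 1 r j = 1 then s.rarr 0 r j else s.rreg 0) ∧
      ∀ r, ∀ j < d, s'.rarr 1 r j = s.rarr 1 r j := by
  refine Runs.forLoop (T := m * 12 + 3) (fun l s' => (∀ r < l, ∀ j < m,
      s'.rarr 1 r (d + j) = if s.narr 1 r j = 1 then s.rarr 0 r j else s.rreg 0) ∧
      ∀ r, ∀ j < d, s'.rarr 1 r j = s.rarr 1 r j)
    (by decide) (by decide) h0 ⟨fun r hr => absurd hr (by omega), fun _ _ _ => rfl⟩ ?_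
    (fun s' _ h => h)
  rintro l s' hl h9 hF ⟨hI, hI'⟩
  have r0 := (hF.nreg 0 (by decide)).trans h0
  have r1 := (hF.nreg 1 (by decide)).trans h1
  have r8 := (hF.nreg 8 (by decide)).trans h8
  refine (runs_fillInputRow r0 r1 r8 h9).mono le_rfl ?_
  rintro s'' - ⟨h₁, h₂⟩
  rw [hF.narr 1 (by decide), hF.rreg 0 (by decide), hF.rarr 0 (by decide)] at h₁
  change (∀ r < l + 1, ∀ j < m, s''.rarr 1 r (d + j) = _) ∧ ∀ r, ∀ j < d, s''.rarr 1 r j = _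
  constructor
  · intro r hr j hj
    by_cases hrl : r = l
    · rw [hrl, h₁ j hj]
    · rw [h₂ r _ (Or.inl hrl)]
      exact hI r (by omega) j hj
  · intro r j hj
    rw [h₂ r j (Or.inr hj), hI' r j hj]

/-- Marks all columns as free. -/
def clearAssignment : Prog := forLoop 9 3 (.instr (.nstore 3 2 9 0))

theorem runs_clearAssignment {k : ℕ} (h0 : s.nreg 0 = d) (h2 : s.nreg 2 = 0) (h3 : s.nreg 3 = k) :
    Runs clearAssignment s (k * 3 + 2) fun s' => ∀ j < k, s'.narr 3 0 j = d := by
  refine (Runs.forLoop (T := 1) (Q := fun s' => s'.narr 3 0 = upto k (fun _ => d) (s.narr 3 0))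
    (fun j s' => s'.narr 3 0 = upto j (fun _ => d) (s.narr 3 0)) (by decide)
    (by decide) h3 (by rw [upto_zero]; rfl) ?_ (fun s' _ h => h)).mono le_rfl
    (fun s' _ h j hj => by rw [h, upto_of_lt _ _ hj])
  intro j s' hj h9 hF hI
  have r0 := (hF.nreg 0 (by decide)).trans h0
  have r2 := (hF.nreg 2 (by decide)).trans h2
  refine Runs.instr ?_
  simp [Instr.apply, Mem.setN, h9, r0, r2, setCell_row]
  rw [hI, update_upto rfl]

/-- Writes the input matrix of the assignment. -/
def writeOutput : Prog :=
  .instr (.ncopy 12 0) ;;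
  forLoop 9 1 (
    .instr (.nload 11 3 2 12) ;;
    .ite (.nlt 11 0) (.instr (.nstore 2 11 9 8) ;; .instr (.ninc 12)) (.instr (.ninc 12)))

/-- Only ones are written, whence the hypothesis that the output array is zero. A free column
carries the marker `d`, which fails the test against register `0`. -/
theorem runs_writeOutput (h0 : s.nreg 0 = d) (h1 : s.nreg 1 = m) (h2 : s.nreg 2 = 0)
    (h8 : s.nreg 8 = 1) (hout : ∀ r j, s.narr 2 r j = 0) :
    Runs writeOutput s (m * 12 + 3) fun s' => ∀ r < d, ∀ j < m,
      s'.narr 2 r j = if s.narr 3 0 (d + j) = r then 1 else 0 := by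
  refine Runs.cons (Runs.forLoop (T := 10) (K := m) (fun l s' => s'.nreg 12 = d + l ∧
      ∀ r < d, ∀ j, s'.narr 2 r j = if j < l ∧ s.narr 3 0 (d + j) = r then 1 else 0)
    (by decide) (by decide) (by simp [Instr.apply, h1])
    (by simp [Instr.apply, Mem.setN, h0, hout]) ?_
    (fun s' _ h r hr j hj => by rw [h.2 r hr j]; simp [hj]))
  rintro l s' hl h9 hF ⟨h12, hI⟩
  have r0 := hF.nreg 0 (by decide)
  have r2 := hF.nreg 2 (by decide)
  have r8 := hF.nreg 8 (by decide)
  have hp := hF.narr 3 (by decide)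
  simp [Instr.apply, h0, h2, h8] at r0 r2 r8 hp
  refine Runs.cons (Runs.ite (fun hb => Runs.cons (Runs.instr ?_)) (fun hb => Runs.instr ?_))
  · simp [Test.Holds, Instr.apply, r0, r2, h12, hp] at hb
    simp [Instr.apply, Mem.setN, r2, r8, h9, h12, hp, Nat.add_assoc]
    intro r hr j
    simp only [setCell]
    rw [hI r hr j]
    by_cases hjl : j = l
    · subst hjl
      simp [eq_comm]
    · have : j ≤ l ↔ j < l := by omega
      simp [hjl, this]
  · simp [Test.Holds, Instr.apply, r0, r2, h12, hp] at hb
    simp [Instr.apply, Mem.setN, h12, Nat.add_assoc]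
    intro r hr j
    rw [hI r hr j]
    by_cases hjl : j = l
    · subst hjl
      simp
      omega
    · have : j ≤ l ↔ j < l := by omega
      simp [this]

end Setup

end StructCtrl

/-! ### Correctness and running time of the whole program -/

namespace StructCtrl

section Program

variable {d m : ℕ}

/-- Computes the input matrix of a minimum cost maximum matching. -/
def matchingProgram : Prog :=
  computeWidth ;; computeBound ;; fillState ;; fillInput ;; clearAssignment ;; hungarian ;;
  writeOutput

/-- The costs of all pairs of a column and a row; non-edges cost more than any matching. -/
structure IsCostTable (A : SparsityMatrix d d) (B : SparsityMatrix d m) (w : Fin d → Fin m → ℝ)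
    (c : ℕ → ℕ → ℝ) : Prop where
  state : ∀ i j : Fin d, c i j = if A i j = true then 0 else 1 + connectionCost w B
  input : ∀ (i : Fin d) (j : Fin m),
    c i (d + j) = if B i j = true then w i j else 1 + connectionCost w B

theorem connectionCost_nonneg {B : SparsityMatrix d m} {w : Fin d → Fin m → ℝ}
    (hw : ∀ i j, B i j = true → 0 ≤ w i j) : 0 ≤ connectionCost w B :=
  Finset.sum_nonneg fun i _ => Finset.sum_nonneg fun j _ => by
    split_ifs with h
    · exact hw i j h
    · exact le_rfl

namespace IsCostTable

variable {A : SparsityMatrix d d} {B : SparsityMatrix d m} {w : Fin d → Fin m → ℝ}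
  {c : ℕ → ℕ → ℝ}

theorem apply_eq (h : IsCostTable A B w c) (i : Fin d) (x : Fin d ⊕ Fin m) :
    c i (finSumFinEquiv x) =
      if (x, i) ∈ gammaAB A B then edgeCost w (x, i) else 1 + connectionCost w B := by
  rcases x with j | j
  · simp [mem_gammaAB_inl, edgeCost, h.state]
  · simp [mem_gammaAB_inr, edgeCost, h.input]

theorem nonneg (h : IsCostTable A B w c) (hw : ∀ i j, B i j = true → 0 ≤ w i j) {r j : ℕ}
    (hr : r < d) (hj : j < d + m) : 0 ≤ c r j := by
  have hC := connectionCost_nonneg hw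
  have h1 := h.apply_eq ⟨r, hr⟩ (finSumFinEquiv.symm ⟨j, hj⟩)
  rw [Equiv.apply_symm_apply] at h1
  change c r j = _ at h1
  rw [h1]
  generalize finSumFinEquiv.symm ⟨j, hj⟩ = x
  split_ifs with hx
  · rcases x with x | x
    · exact le_rfl
    · exact hw _ _ (mem_gammaAB_inr.1 hx)
  · linarith

/-- With nonnegative costs, zero potentials are feasible, and an empty assignment satisfies the
remaining conditions. -/
theorem dualPair_zero (h : IsCostTable A B w c) (hw : ∀ i j, B i j = true → 0 ≤ w i j)
    {u v : ℕ → ℝ} {p : ℕ → ℕ} (hu : ∀ r, u r = 0) (hv : ∀ j, v j = 0)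
    (hp : ∀ j < d + m, p j = d) : DualPair d (d + m) c 0 u v p where
  feas r hr j hj := by
    rw [hu, hv, add_zero]
    exact h.nonneg hw hr hj
  range j hj := Or.inr (hp j hj)
  inj j hj j' _ hlt := by
    rw [hp j hj] at hlt
    omega
  tight j hj hlt := by
    rw [hp j hj] at hlt
    omega
  nonpos j _ := (hv j).le
  free j _ _ := hv j
  cover r hr := absurd hr (by omega)

/-- An optimal assignment for the table of costs is a minimum cost maximum matching. -/
theorem exists_isMCMM (h : IsCostTable A B w c) (hAB : StructurallyControllable A B)
    (hw : ∀ i j, B i j = true → 0 ≤ w i j) {u v : ℕ → ℝ} {p : ℕ → ℕ}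
    (hd : DualPair d (d + m) c d u v p) :
    ∃ M, IsMCMM (gammaAB A B) (edgeCost w) M ∧ ∀ (i : Fin d) (j : Fin m),
      (if p (d + j) = i then 1 else 0) = ((inputMatrixOf M : SparsityMatrix d m) i j).toNat := by
  have hex : ∀ r : Fin d, ∃ j, j < d + m ∧ p j = r := fun r => by
    obtain ⟨j, hj, hjr⟩ := hd.cover r r.2
    exact ⟨j, hj, hjr⟩
  choose f hf hfp using hex
  let σ : Fin d → Fin d ⊕ Fin m := fun r => finSumFinEquiv.symm ⟨f r, hf r⟩
  have hσf : ∀ r, (finSumFinEquiv (σ r) : ℕ) = f r := fun r => by simp [σ]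
  have hσ : Function.Injective σ := by
    intro r r' hr
    apply Fin.ext
    rw [← hfp r, ← hfp r', ← hσf, ← hσf, hr]
  have hle : ∀ σ' : Fin d → Fin d ⊕ Fin m, Function.Injective σ' →
      (∀ r, (σ' r, r) ∈ gammaAB A B) → ∑ r : Fin d, c r (f r) ≤ ∑ r, edgeCost w (σ' r, r) := by
    intro σ' hσ' hE'
    refine (hd.optimal hf hfp (g := fun r => finSumFinEquiv (σ' r)) (fun r => Fin.is_lt _)
      (fun r r' hr => hσ' (finSumFinEquiv.injective (Fin.ext hr)))).trans (le_of_eq ?_)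
    exact Finset.sum_congr rfl fun r _ => by rw [h.apply_eq, if_pos (hE' r)]
  -- One non-edge would already cost `1 + connectionCost w B`, more than the saturating matching
  -- that structural controllability provides.
  have hE : ∀ r, (σ r, r) ∈ gammaAB A B := by
    intro r
    by_contra hr
    obtain ⟨σ', hσ', hE'⟩ := hAB.exists_injective
    have h1 : c r (f r) = 1 + connectionCost w B := by rw [← hσf, h.apply_eq, if_neg hr]
    have h2 : c r (f r) ≤ ∑ r : Fin d, c r (f r) :=
      Finset.single_le_sum (f := fun r : Fin d => c r (f r))
        (fun i _ => h.nonneg hw i.2 (hf i)) (Finset.mem_univ r)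
    have h3 := hle σ' hσ' hE'
    have h4 := sum_edgeCost_le_connectionCost hw hE'
    linarith
  refine ⟨matchingOf σ, isMCMM_matchingOf hσ hE fun σ' hσ' hE' => ?_, fun i j => ?_⟩
  · refine (le_of_eq (Finset.sum_congr rfl fun r _ => ?_)).trans (hle σ' hσ' hE')
    rw [← hσf, h.apply_eq, if_pos (hE r)]
  · have hiff : p (d + j) = i ↔ σ i = Sum.inr j := by
      constructor
      · intro hp
        apply finSumFinEquiv.injective
        apply Fin.ext
        rw [hσf, finSumFinEquiv_apply_right, Fin.val_natAdd]
        refine hd.inj _ (hf i) _ (by omega) ?_ ?_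
        · rw [hfp]
          exact i.2
        · rw [hfp, hp]
      · intro hi
        have h1 := hσf i
        rw [hi, finSumFinEquiv_apply_right, Fin.val_natAdd] at h1
        rw [h1, hfp]
    rw [inputMatrixOf_matchingOf]
    by_cases hi : σ i = Sum.inr j
    · simp [hi, hiff.2 hi]
    · simp [hi, mt hiff.1 hi]

end IsCostTable

theorem runs_matchingProgram {A : SparsityMatrix d d} {B : SparsityMatrix d m}
    {w : Fin d → Fin m → ℝ} (hAB : StructurallyControllable A B)
    (hw : ∀ i j, B i j = true → 0 ≤ w i j) :
    Runs matchingProgram (inputMem A B w)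
      ((m * 3 + 4) + ((d * (m * 12 + 4) + 3) + ((d * (d * 12 + 4) + 2) + ((d * (m * 12 + 5) + 2) +
        (((d + m) * 3 + 2) + ((d * (d * (d * 12 + (d + m) * 41 + 40) + (d + m) * 12 + 22) + 2) +
        (m * 12 + 3)))))))
      fun s => ∃ M, IsMCMM (gammaAB A B) (edgeCost w) M ∧
        Outputs s (inputMatrixOf M : SparsityMatrix d m) := by
  set s₀ := inputMem A B w with hs₀
  have i0 : s₀.nreg 0 = d := by simp [hs₀, inputMem]
  have i1 : s₀.nreg 1 = m := by simp [hs₀, inputMem]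
  have i2 : s₀.nreg 2 = 0 := by simp [hs₀, inputMem]
  refine Runs.seq (runs_computeWidth i0 i1) fun s₁ hF₁ h₁ => ?_
  have j0 := (hF₁.nreg 0 (by decide)).trans i0
  have j1 := (hF₁.nreg 1 (by decide)).trans i1
  have j2 := (hF₁.nreg 2 (by decide)).trans i2
  refine Runs.seq (runs_computeBound j0 j1 h₁.2) fun s₂ hF₂ h₂ => ?_
  have k0 := (hF₂.nreg 0 (by decide)).trans j0
  have k1 := (hF₂.nreg 1 (by decide)).trans j1
  have k2 := (hF₂.nreg 2 (by decide)).trans j2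
  have k3 := (hF₂.nreg 3 (by decide)).trans h₁.1
  have k8 := (hF₂.nreg 8 (by decide)).trans h₁.2
  refine Runs.seq (runs_fillState k0 k8) fun s₃ hF₃ h₃ => ?_
  have l0 := (hF₃.nreg 0 (by decide)).trans k0
  have l1 := (hF₃.nreg 1 (by decide)).trans k1
  have l2 := (hF₃.nreg 2 (by decide)).trans k2
  have l3 := (hF₃.nreg 3 (by decide)).trans k3
  have l8 := (hF₃.nreg 8 (by decide)).trans k8
  refine Runs.seq (runs_fillInput l0 l1 l8) fun s₄ hF₄ h₄ => ?_
  have m0 := (hF₄.nreg 0 (by decide)).trans l0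
  have m1 := (hF₄.nreg 1 (by decide)).trans l1
  have m2 := (hF₄.nreg 2 (by decide)).trans l2
  have m3 := (hF₄.nreg 3 (by decide)).trans l3
  have m8 := (hF₄.nreg 8 (by decide)).trans l8
  refine Runs.seq (runs_clearAssignment m0 m2 m3) fun s₅ hF₅ h₅ => ?_
  have henv : Env d (d + m) (s₅.rarr 1) s₅ :=
    ⟨(hF₅.nreg 0 (by decide)).trans m0, (hF₅.nreg 2 (by decide)).trans m2,
      (hF₅.nreg 3 (by decide)).trans m3, (hF₅.nreg 8 (by decide)).trans m8, rfl⟩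
  have hA : s₂.narr 0 = s₀.narr 0 := by rw [hF₂.narr 0 (by decide), hF₁.narr 0 (by decide)]
  have hB : s₃.narr 1 = s₀.narr 1 := by
    rw [hF₃.narr 1 (by decide), hF₂.narr 1 (by decide), hF₁.narr 1 (by decide)]
  have hW : s₃.rarr 0 = s₀.rarr 0 := by
    rw [hF₃.rarr 0 (by decide), hF₂.rarr 0 (by decide), hF₁.rarr 0 (by decide)]
  have vA : ∀ i j : Fin d, s₀.narr 0 i j = 1 ↔ A i j = true := fun i j => by
    simp [hs₀, inputMem, padded]
  have vB : ∀ (i : Fin d) (j : Fin m), s₀.narr 1 i j = 1 ↔ B i j = true := fun i j => by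
    simp [hs₀, inputMem, padded]
  have vW : ∀ (i : Fin d) (j : Fin m), s₀.rarr 0 i j = w i j := fun i j => by
    simp [hs₀, inputMem, padded]
  have hM : s₂.rreg 0 = 1 + connectionCost w B := by
    rw [h₂, hF₁.narr 1 (by decide), hF₁.rarr 0 (by decide), connectionCost, Finset.sum_range]
    congr 1
    refine Finset.sum_congr rfl fun i _ => ?_
    rw [Finset.sum_range]
    exact Finset.sum_congr rfl fun j _ => by rw [vW, if_congr (vB i j) rfl rfl]
  have hM₃ : s₃.rreg 0 = 1 + connectionCost w B := (hF₃.rreg 0 (by decide)).trans hM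
  have htab : IsCostTable A B w (s₅.rarr 1) := by
    rw [hF₅.rarr 1 (by decide)]
    constructor
    · intro i j
      rw [h₄.2 i j j.2, h₃ i i.2 j j.2, hA, hM, if_congr (vA i j) rfl rfl]
    · intro i j
      rw [h₄.1 i i.2 j j.2, hB, hW, hM₃, vW, if_congr (vB i j) rfl rfl]
  have hd₅ : DualPair d (d + m) (s₅.rarr 1) 0 (s₅.rarr 2 0) (s₅.rarr 3 0) (s₅.narr 3 0) := by
    refine htab.dualPair_zero hw (fun r => ?_) (fun j => ?_) h₅
    · rw [hF₅.rarr 2 (by decide), hF₄.rarr 2 (by decide), hF₃.rarr 2 (by decide),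
        hF₂.rarr 2 (by decide), hF₁.rarr 2 (by decide)]
      simp [hs₀, inputMem]
    · rw [hF₅.rarr 3 (by decide), hF₄.rarr 3 (by decide), hF₃.rarr 3 (by decide),
        hF₂.rarr 3 (by decide), hF₁.rarr 3 (by decide)]
      simp [hs₀, inputMem]
  refine Runs.seq (runs_hungarian henv (Nat.le_add_right d m) hd₅) fun s₆ hF₆ h₆ => ?_
  have env₆ := henv.frame hF₆
  refine (runs_writeOutput env₆.n0 ?_ env₆.n2 env₆.n8 ?_).mono le_rfl ?_
  · rw [hF₆.nreg 1 (by decide), hF₅.nreg 1 (by decide), m1]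
  · intro r j
    rw [hF₆.narr 2 (by decide), hF₅.narr 2 (by decide), hF₄.narr 2 (by decide),
      hF₃.narr 2 (by decide), hF₂.narr 2 (by decide), hF₁.narr 2 (by decide)]
    simp [hs₀, inputMem]
  · intro s₇ _ h₇
    obtain ⟨M, hMM, hMo⟩ := htab.exists_isMCMM hAB hw h₆
    refine ⟨M, hMM, fun i j => ?_⟩
    rw [h₇ i i.2 j j.2, hMo]

/-- Both dimensions are replaced by `N = d + m`. Since `N ≥ 1`, the lower powers and the constant
are absorbed: `53 + 88 + 53 + 18 ≤ 300`. -/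
theorem matchingProgram_time_le (hd : 0 < d) :
    (m * 3 + 4) + ((d * (m * 12 + 4) + 3) + ((d * (d * 12 + 4) + 2) + ((d * (m * 12 + 5) + 2) +
      (((d + m) * 3 + 2) + ((d * (d * (d * 12 + (d + m) * 41 + 40) + (d + m) * 12 + 22) + 2) +
      (m * 12 + 3)))))) ≤ 300 * (d + m) ^ 3 := by
  obtain ⟨N, hN⟩ : ∃ N, N = d + m := ⟨_, rfl⟩
  have hdN : d ≤ N := by omega
  have hmN : m ≤ N := by omega
  have hN1 : 1 ≤ N := by omega
  have hN2 : N ≤ N ^ 2 := by nlinarith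
  have hN3 : N ^ 2 ≤ N ^ 3 := Nat.pow_le_pow_right hN1 (by norm_num)
  rw [← hN]
  calc _ ≤ (N * 3 + 4) + ((N * (N * 12 + 4) + 3) + ((N * (N * 12 + 4) + 2) +
        ((N * (N * 12 + 5) + 2) + ((N * 3 + 2) +
        ((N * (N * (N * 12 + N * 41 + 40) + N * 12 + 22) + 2) + (N * 12 + 3)))))) := by gcongr
    _ = 53 * N ^ 3 + 88 * N ^ 2 + 53 * N + 18 := by ring
    _ ≤ 300 * N ^ 3 := by omega

/-- For `d = 0` the empty matching is perfect. Positivity excludes `d + m = 0`, where the time bound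
would be zero. -/
theorem pos_of_not_perfect {A : SparsityMatrix d d}
    (hA : ¬ ∃ M, IsPerfectMatching (gammaA A) M) : 0 < d := by
  rcases Nat.eq_zero_or_pos d with rfl | h
  · exact absurd ⟨∅, ⟨by simp, by simp⟩, fun l => l.elim0, fun r => r.elim0⟩ hA
  · exact h

end Program

end StructCtrl

theorem mainTheorem2 :
    -- every minimum cost maximum matching yields a solution of the optimisation problem
    (∀ (d m : ℕ) (A : StructCtrl.SparsityMatrix d d) (B : StructCtrl.SparsityMatrix d m)
        (w : Fin d → Fin m → ℝ),
      StructCtrl.StructurallyControllable A B →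
      (∀ i j, B i j = true → 0 ≤ w i j) →
      StructCtrl.IsStronglyConnected (StructCtrl.stateDigraph A) →
      (¬ ∃ M, StructCtrl.IsPerfectMatching (StructCtrl.gammaA A) M) →
      ∀ M, StructCtrl.IsMCMM (StructCtrl.gammaAB A B) (StructCtrl.edgeCost w) M →
        StructCtrl.StructurallyControllable A (StructCtrl.inputMatrixOf M) ∧
        StructCtrl.SolvesMinCost A B w (StructCtrl.inputMatrixOf M)) ∧
    -- one program computes the input matrix of such a matching in `O((d + m)³)` steps
    (∃ (P : StructCtrl.Prog) (C : ℕ),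
      ∀ (d m : ℕ) (A : StructCtrl.SparsityMatrix d d) (B : StructCtrl.SparsityMatrix d m)
        (w : Fin d → Fin m → ℝ),
      StructCtrl.StructurallyControllable A B →
      (∀ i j, B i j = true → 0 ≤ w i j) →
      StructCtrl.IsStronglyConnected (StructCtrl.stateDigraph A) →
      (¬ ∃ M, StructCtrl.IsPerfectMatching (StructCtrl.gammaA A) M) →
      ∃ (t : ℕ) (s : StructCtrl.Mem),
        StructCtrl.Exec P (StructCtrl.inputMem A B w) t s ∧
        t ≤ C * (d + m) ^ 3 ∧
        ∃ M, StructCtrl.IsMCMM (StructCtrl.gammaAB A B) (StructCtrl.edgeCost w) M ∧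
          StructCtrl.Outputs s (StructCtrl.inputMatrixOf M : StructCtrl.SparsityMatrix d m)) := by
  refine ⟨fun d m A B w hAB hw hA hperf M hM => ?_, StructCtrl.matchingProgram, 300,
    fun d m A B w hAB hw _ hperf => ?_⟩
  · have h := hM.solvesMinCost hAB hw hA hperf
    exact ⟨h.1.2, h⟩
  · obtain ⟨t, s, he, ht, hM⟩ := StructCtrl.runs_matchingProgram hAB hw
    exact ⟨t, s, he,
      ht.trans (StructCtrl.matchingProgram_time_le (StructCtrl.pos_of_not_perfect hperf)), hM⟩
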